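/- **Setting.** Consider a finite scenario tree with stages $0,\dots,T$ ($T\ge 1$): a root $n_0$, a unique child $n_1$ of the root (stage 1, deterministic), and leaves that are exactly the nodes of stage $T$; it represents a discrete process $(\xi_t)$, possibly interstage dependent, with finitely many realizations at each stage. $C(n)$ is the set of children of $n$, $\tau_n$ its stage, $\Phi_m>0$ the transition probability from the parent of $m$ to $m$ (with $\sum_{m\in C(n)}\Phi_m=1$ for every non-leaf $n$), and $\xi_m=(\Psi_m,b_m,(A_{\tau,m})_{0\le \tau\le \tau_m})$ the realization at $m$. Decisions are in $\mathbb R^d$, $x_0$ is given, and $x_{[n]}$ is the history of decisions from $n_1$ to $n$. For $t=\tau_m$ put $$X_t(x_0,x_{1:t-1},\xi_m)=\Big\{x_t\in\mathcal X_t:\ g_t(x_0,x_{1:t},\Psi_m)\le 0,\ \sum_{\tau=0}^{t}A_{\tau,m}x_\tau=b_m\Big\}.$$ To every node $n$ that is neither the root nor a leaf belong a coherent risk measure $\rho_n:\mathbb R^{|C(n)|}\to\mathbb R$ and a convex set $\mathcal P_n\subset\{p\ge 0:\sum_{m\in C(n)}p_m\Phi_m=1\}$ with $\rho_n(Z)=\sup_{p\in\mathcal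 P_n}\sum_{m\in C(n)}p_m\Phi_mZ_m$ for all $Z$. The recourse functions are $\mathcal Q_n\equiv 0$ for a leaf $n$ and, for the other non-root nodes, $$\mathcal Q_n(x_{[n]})=\sup_{p\in\mathcal P_n}\sum_{m\in C(n)}p_m\Phi_m\,\mathfrak Q_n(x_{[n]},\xi_m),\qquad \mathfrak Q_n(x_{[n]},\xi_m)=\inf_{x_m\in X_{\tau_m}(x_0,x_{[n]},\xi_m)} f_{\tau_m}(x_{[n]},x_m,\Psi_m)+\mathcal Q_m(x_{[n]},x_m).$$ The first-stage problem is the problem on the right for $n=n_0$, $m=n_1$; its optimal value is $\mathcal Q_{n_0}(x_0)$. **Assumption (H2).** For $t=1,\dots,T$ and every node $m$ of stage $t$ (where $Y^\varepsilon$ is the set of points at Euclidean distance at most $\varepsilon$ from a point of $Y$): 1) $\mathcal X_t\subset\mathbb R^d$ is nonempty, convex and compact. 2) $f_t(x_{1:t},\cdot)$ is measurable for every $x_{1:t}$, and $f_t(\cdot,\Psi_m)$, with values in $\mathbb R\cup\{+\infty\}$, is proper, convex and lower semicontinuous. 3) Each component of $g_t(x_0,\cdot,\Psi_m)$, with values in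 $\mathbb R\cup\{+\infty\}$, is convex and lower semicontinuous. 4) There is $\varepsilon>0$ (the same for all nodes of stage $t$) such that $[\mathcal X_1\times\dots\times\mathcal X_{t-1}]^\varepsilon\times\mathcal X_t\subset\mathrm{dom}\,f_t(\cdot,\Psi_m)$ and $X_t(x_0,x_{1:t-1},\xi_m)\neq\emptyset$ for every $x_{1:t-1}\in[\mathcal X_1\times\dots\times\mathcal X_{t-1}]^\varepsilon$. 5) If $t\ge2$, there is $\bar x=(\bar x_1,\dots,\bar x_t)\in\mathcal X_1\times\dots\times\mathcal X_{t-1}\times\mathrm{ri}(\mathcal X_t)$ in $\mathrm{ri}\{g_t(x_0,\cdot,\Psi_m)\le0\}$ with $\bar x_t\in X_t(x_0,\bar x_{1:t-1},\xi_m)$. **Algorithm.** It builds $\mathcal Q_n^k(x)=\max_{0\le\ell\le k}\big(\theta_n^\ell+\langle\beta_n^\ell,x-x_{[n]}^\ell\rangle\big)$ for the non-root nodes $n$, where $\theta_n^0=-\infty$ if $n$ is not a leaf, and $\theta_n^k=0,\beta_n^k=0$ for all $k$ if $n$ is a leaf. $\mathfrak Q_n^{k}(x,\xi_m)$ is defined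 as $\mathfrak Q_n(x,\xi_m)$ with $\mathcal Q_m^{k}$ in place of $\mathcal Q_m$ (and $0\cdot(\pm\infty)=0$ in weighted sums). At iteration $k\ge1$ a scenario, i.e. a path $(n_0^k,n_1^k,\dots,n_T^k)$ from the root to a leaf, is sampled. Stage by stage, for every non-root node $m$, with parent $n$, $x_m^k$ is an optimal solution of the problem that defines $\mathfrak Q_n^{k-1}(x_{[n]}^k,\xi_m)$. For a node $n$ of stage $1,\dots,T-1$ not on the sampled path, $\theta_n^k=\mathcal Q_n^{k-1}(x_{[n]}^k)$ and $\beta_n^k\in\partial\mathcal Q_n^{k-1}(x_{[n]}^k)$. If $n$ is on the sampled path, one takes subgradients $\pi_{k,m}$ of $\mathfrak Q_n^{k-1}(\cdot,\xi_m)$ at $x_{[n]}^k$ for $m\in C(n)$ and $p_k\in\mathcal P_n$ with $$\theta_n^k=\sup_{p\in\mathcal P_n}\sum_{m\in C(n)}p_m\Phi_m\mathfrak Q_n^{k-1}(x_{[n]}^k,\xi_m)=\sum_{m\in C(n)}p_{k,m}\Phi_m\mathfrak Q_n^{k-1}(x_{[n]}^k,\xi_m),\qquad \beta_n^k=\sum_{m\in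 C(n)}p_{k,m}\Phi_m\pi_{k,m}.$$ Each sampled scenario has the law of the process. The only randomness is that of the samples: the decisions $x_n^k$ are functions of the scenarios of iterations $1,\dots,k-1$, and $\theta_n^k,\beta_n^k$ are functions of the scenarios of iterations $1,\dots,k$. **Theorem.** Assume (H2) and that the scenarios sampled at the iterations $k=1,2,\dots$ are independent. Then: (i) almost surely, $\lim_{k\to\infty}\big(\mathcal Q_n^k(x_{[n]}^k)-\mathcal Q_n(x_{[n]}^k)\big)=0$ for every node $n\ne n_0$; (ii) almost surely, $\lim_{k\to\infty}\mathfrak Q_{n_0}^k(x_0,\xi_1)=\mathcal Q_{n_0}(x_0)$, i.e. the optimal values of the approximate first-stage problems converge to the optimal value of the first-stage problem; moreover, if $f_1(\cdot,\Psi_1)$ is continuous on $\mathcal X_1$, then almost surely every accumulation point of $(x_{n_1}^k)_{k\ge1}$ is an optimal solution of the first-stage problem. -/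

import Mathlib

open Filter Topology MeasureTheory ProbabilityTheory

/-! ### Scenario trees -/

/-- A finite scenario tree with stages `0, 1, …, T` of a discrete process with finitely many
realizations.  `Node t` is the set of nodes of stage `t`; there is one root (stage `0`), one
first-stage node (its only child), and `Φ m` is the transition probability from the parent
of `m` to `m`.  The leaves are exactly the nodes of stage `T`. -/
structure ScenarioTree (T : ℕ) where
  Node : ℕ → Type
  [instFintype : ∀ t, Fintype (Node t)]
  [instDecidableEq : ∀ t, DecidableEq (Node t)]
  parent : ∀ {t : ℕ}, Node (t + 1) → Node t
  root : Node 0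
  eq_root : ∀ n : Node 0, n = root
  first : Node 1
  eq_first : ∀ n : Node 1, n = first
  isEmpty_of_lt : ∀ t : ℕ, T < t → IsEmpty (Node t)
  Φ : ∀ {t : ℕ}, Node (t + 1) → ℝ
  Φ_pos : ∀ {t : ℕ} (m : Node (t + 1)), 0 < Φ m
  sum_Φ : ∀ t : ℕ, t < T → ∀ n : Node t,
    (∑ m ∈ (Finset.univ : Finset (Node (t + 1))).filter (fun m => parent m = n), Φ m) = 1

attribute [instance] ScenarioTree.instFintype ScenarioTree.instDecidableEq

namespace ScenarioTree

variable {T : ℕ} (S : ScenarioTree T)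

/-- The set `C(n)` of children of `n`. -/
abbrev Child {t : ℕ} (n : S.Node t) : Type := {m : S.Node (t + 1) // S.parent m = n}

/-- The probability that the process passes through a node. -/
def prob : ∀ {t : ℕ}, S.Node t → ℝ
  | 0, _ => 1
  | _ + 1, m => prob (S.parent m) * S.Φ m

/-- A scenario: a path `(n_0, n_1, …, n_T)` from the root to a leaf. -/
structure Scenario where
  node : ∀ t : ℕ, t ≤ T → S.Node t
  parent_node : ∀ (t : ℕ) (h : t + 1 ≤ T),
    S.parent (node (t + 1) h) = node t (Nat.le_of_succ_le h)

instance : MeasurableSpace S.Scenario := ⊤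

/-- `s k` is the scenario sampled at iteration `k ≥ 1`: every sampled scenario has the law of the
process, and the samples of different iterations are independent. -/
structure IsIndependentSampling {Ω : Type*} [MeasurableSpace Ω] (μ : Measure Ω)
    (s : ℕ → Ω → S.Scenario) : Prop where
  measurable : ∀ k : ℕ, 1 ≤ k → Measurable (s k)
  law : ∀ k : ℕ, 1 ≤ k → ∀ l : S.Node T,
    μ {ω | (s k ω).node T le_rfl = l} = ENNReal.ofReal (S.prob l)
  indep : iIndepFun (fun k : ℕ => s (k + 1)) μ

end ScenarioTree

/-! ### Convex analysis for functions with values in the extended reals -/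

/-- Convexity of an extended-real-valued function: its epigraph is convex. -/
def EConvex {V : Type*} [AddCommGroup V] [Module ℝ V] (F : V → EReal) : Prop :=
  Convex ℝ {z : V × ℝ | F z.1 ≤ (z.2 : EReal)}

/-- The decision space `ℝ^d`. -/
abbrev Dec (d : ℕ) : Type := EuclideanSpace ℝ (Fin d)

/-- Decision histories `x_{1:t} = (x_1, …, x_t)`; the entry with index `i : Fin t` is the decision
of stage `i + 1`. -/
abbrev Hist (d t : ℕ) : Type := Fin t → Dec d

namespace Hist

variable {d t : ℕ}

/-- The history `(x_{1:t}, y)`. -/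
def snoc (x : Hist d t) (y : Dec d) : Hist d (t + 1) :=
  Fin.snoc (α := fun _ => Dec d) x y

/-- The usual scalar product of `ℝ^(d t)`. -/
noncomputable def dot (x y : Hist d t) : ℝ := ∑ i, inner ℝ (x i) (y i)

end Hist

/-- `v` is a subgradient of `F` at `x`.  (At a point where `F` is `-∞` every `v` is one.) -/
def IsSubgradientAt {d t : ℕ} (F : Hist d t → EReal) (x v : Hist d t) : Prop :=
  ∀ y : Hist d t, F x + ((Hist.dot v (y - x) : ℝ) : EReal) ≤ F y

/-! ### Risk measures -/

/-- Coherent risk measures (for costs) on a finite set of outcomes. -/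
structure IsCoherentRisk {ι : Type*} (ρ : (ι → ℝ) → ℝ) : Prop where
  mono : ∀ Z W : ι → ℝ, (∀ i, Z i ≤ W i) → ρ Z ≤ ρ W
  translation : ∀ (Z : ι → ℝ) (c : ℝ), ρ (fun i => Z i + c) = ρ Z + c
  pos_homogeneous : ∀ (c : ℝ) (Z : ι → ℝ), 0 ≤ c → ρ (fun i => c * Z i) = c * ρ Z
  subadditive : ∀ Z W : ι → ℝ, ρ (fun i => Z i + W i) ≤ ρ Z + ρ W

/-- `D` is a dual set of `ρ` with respect to the probability weights `w`: a convex set of densities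
such that `ρ Z` is the supremum over `p ∈ D` of the expectation of `Z` under the density `p`. -/
structure IsDualSet {ι : Type*} [Fintype ι] (w : ι → ℝ) (ρ : (ι → ℝ) → ℝ)
    (D : Set (ι → ℝ)) : Prop where
  convex : Convex ℝ D
  density : D ⊆ {p | (∀ i, 0 ≤ p i) ∧ ∑ i, p i * w i = 1}
  isLUB : ∀ Z : ι → ℝ, IsLUB ((fun p : ι → ℝ => ∑ i, p i * w i * Z i) '' D) (ρ Z)

/-- The objective `∑ p_i w_i Z_i` for costs in the extended reals (with `0 · (±∞) = 0`). -/
noncomputable def weightedCost {ι : Type*} [Fintype ι] (w p : ι → ℝ) (Z : ι → EReal) : EReal :=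
  ∑ i, ((p i * w i : ℝ) : EReal) * Z i

/-- The risk `sup_{p ∈ D} ∑ p_i w_i Z_i` of costs in the extended reals. -/
noncomputable def dualRisk {ι : Type*} [Fintype ι] (w : ι → ℝ) (D : Set (ι → ℝ))
    (Z : ι → EReal) : EReal :=
  ⨆ p ∈ D, weightedCost w p Z

/-- For finite costs, `dualRisk` is the risk measure itself. -/
theorem IsDualSet.dualRisk_coe {ι : Type*} [Fintype ι] {w : ι → ℝ} {ρ : (ι → ℝ) → ℝ}
    {D : Set (ι → ℝ)} (h : IsDualSet w ρ D) (Z : ι → ℝ) :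
    dualRisk w D (fun i => (Z i : EReal)) = (ρ Z : EReal) := by
  have key : ∀ p : ι → ℝ, weightedCost w p (fun i => (Z i : EReal))
      = ((∑ i, p i * w i * Z i : ℝ) : EReal) := by
    intro p
    have hcoe : ∀ (s : Finset ι) (u : ι → ℝ), ((∑ i ∈ s, u i : ℝ) : EReal)
        = ∑ i ∈ s, (u i : EReal) := by
      intro s u
      classical
      induction s using Finset.induction_on with
      | empty => simp
      | insert a s ha ih => rw [Finset.sum_insert ha, Finset.sum_insert ha, EReal.coe_add, ih]
    rw [weightedCost, hcoe]
    simp only [EReal.coe_mul]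
  unfold dualRisk
  simp only [key]
  have hne : D.Nonempty := by
    by_contra hempty
    rw [Set.not_nonempty_iff_eq_empty] at hempty
    have hb := (h.isLUB Z).2 (show ρ Z - 1 ∈ upperBounds _ by simp [hempty])
    linarith
  obtain ⟨p0, hp0⟩ := hne
  apply le_antisymm
  · exact iSup₂_le fun p hp => EReal.coe_le_coe_iff.2 ((h.isLUB Z).1 ⟨p, hp, rfl⟩)
  · have hbdd : ∀ B : EReal, (∀ p ∈ D, ((∑ i, p i * w i * Z i : ℝ) : EReal) ≤ B) →
        (ρ Z : EReal) ≤ B := by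
      intro B hB
      induction B using EReal.rec with
      | bot => exact absurd (hB p0 hp0) (by simp)
      | top => exact le_top
      | coe c =>
        refine EReal.coe_le_coe_iff.2 ((h.isLUB Z).2 ?_)
        rintro _ ⟨p, hp, rfl⟩
        exact EReal.coe_le_coe_iff.1 (hB p hp)
    exact hbdd _ fun p hp =>
      le_iSup₂ (f := fun (p : ι → ℝ) (_ : p ∈ D) => ((∑ i, p i * w i * Z i : ℝ) : EReal)) p hp

/-! ### The multistage problem -/

/-- The data of a risk-averse multistage stochastic convex program on a scenario tree.  The
decisions are in `ℝ^d`, and the node `m` carries the realization `ξ_m` of the process, which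
consists of `Ψ m`, of `b m` and of the matrices `A m τ` for `τ = 0, …, t` (`t` the stage of `m`).
`ρ n` is the risk measure of the node `n`, and `dualSet n` a dual set of it. -/
structure StochasticProgram {T : ℕ} (S : ScenarioTree T) (d K : ℕ) where
  /-- the number of inequality constraints of each stage -/
  r : ℕ → ℕ
  /-- the number of equality constraints of each stage -/
  q : ℕ → ℕ
  x₀ : Dec d
  X : ℕ → Set (Dec d)
  f : ∀ t : ℕ, Hist d t → (Fin K → ℝ) → EReal
  g : ∀ t : ℕ, Dec d → Hist d t → (Fin K → ℝ) → Fin (r t) → EReal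
  Ψ : ∀ {t : ℕ}, S.Node t → Fin K → ℝ
  A : ∀ {t : ℕ}, S.Node t → Fin (t + 1) → Matrix (Fin (q t)) (Fin d) ℝ
  b : ∀ {t : ℕ}, S.Node t → Fin (q t) → ℝ
  ρ : ∀ {t : ℕ} (n : S.Node t), (S.Child n → ℝ) → ℝ
  dualSet : ∀ {t : ℕ} (n : S.Node t), Set (S.Child n → ℝ)

/-- What the algorithm produces: for every iteration `k` and node `n`, a decision `x_n^k` and the
coefficients `θ_n^k`, `β_n^k` of a cut. -/
structure Iterates {T : ℕ} (S : ScenarioTree T) (d : ℕ) where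
  x : ℕ → ∀ {t : ℕ}, S.Node t → Dec d
  θ : ℕ → ∀ {t : ℕ}, S.Node t → EReal
  β : ℕ → ∀ {t : ℕ}, S.Node t → Hist d t

namespace Iterates

variable {T : ℕ} {S : ScenarioTree T} {d : ℕ} (I : Iterates S d)

/-- The history of decisions `x_{[n]}^k` along the path from the first-stage node to `n`. -/
def hist (k : ℕ) : ∀ {t : ℕ}, S.Node t → Hist d t
  | 0, _ => Fin.elim0
  | _ + 1, m => Hist.snoc (hist k (S.parent m)) (I.x k m)

/-- The approximate recourse function `𝒬_n^k`, the maximum of the cuts `0, …, k` of node `n`. -/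
noncomputable def approx (k : ℕ) {t : ℕ} (n : S.Node t) (z : Hist d t) : EReal :=
  ⨆ l ∈ Finset.range (k + 1), I.θ l n + ((Hist.dot (I.β l n) (z - I.hist l n) : ℝ) : EReal)

end Iterates

namespace StochasticProgram

variable {T : ℕ} {S : ScenarioTree T} {d K : ℕ} (P : StochasticProgram S d K)

/-- At every node that is neither the root nor a leaf, the risk measure is coherent and
`dualSet` is a dual set of it. -/
def HasCoherentRisk : Prop :=
  ∀ t : ℕ, 1 ≤ t → t < T → ∀ n : S.Node t,
    IsCoherentRisk (P.ρ n) ∧ IsDualSet (fun m : S.Child n => S.Φ m.1) (P.ρ n) (P.dualSet n)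

/-- The set `X_{t+1}(x_{0:t}, ξ_m)` of feasible decisions at the node `m` of stage `t + 1` after the
history `x = x_{1:t}`. -/
def feasible {t : ℕ} (m : S.Node (t + 1)) (x : Hist d t) : Set (Dec d) :=
  {y | y ∈ P.X (t + 1) ∧
    (∀ i, P.g (t + 1) P.x₀ (Hist.snoc x y) (P.Ψ m) i ≤ 0) ∧
    ∑ τ : Fin (t + 2), (P.A m τ).mulVec
      (Fin.cons (α := fun _ => Dec d) P.x₀ (Hist.snoc x y) τ).ofLp = P.b m}

/-- The objective `f_{t+1}(x, y, Ψ_m) + V(x, y)` of the problem solved at the node `m` when the cost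
of the later stages is `V`. -/
noncomputable def objective {t : ℕ} (m : S.Node (t + 1)) (V : Hist d (t + 1) → EReal) (x : Hist d t)
    (y : Dec d) : EReal :=
  P.f (t + 1) (Hist.snoc x y) (P.Ψ m) + V (Hist.snoc x y)

/-- The optimal value of the problem solved at the node `m` when the cost of the later stages
is `V`. -/
noncomputable def stageValue {t : ℕ} (m : S.Node (t + 1)) (V : Hist d (t + 1) → EReal)
    (x : Hist d t) : EReal :=
  ⨅ y ∈ P.feasible m x, P.objective m V x y

/-- Backward recursion for the recourse functions, at nodes with `j` stages to go. -/
noncomputable def recourseAux : ℕ → ∀ {t : ℕ}, S.Node t → Hist d t → EReal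
  | 0, _, _, _ => 0
  | j + 1, _, n, x => dualRisk (fun m : S.Child n => S.Φ m.1) (P.dualSet n)
      (fun m : S.Child n => P.stageValue m.1 (recourseAux j m.1) x)

/-- The recourse function `𝒬_n` of a node `n` other than the root: it is zero at the leaves, and
`ρ_n` of the optimal values of the problems at the children of `n` elsewhere. -/
noncomputable def recourse {t : ℕ} (n : S.Node t) (x : Hist d t) : EReal :=
  P.recourseAux (T - t) n x

/-- The optimal value `𝒬_{n_0}(x_0)` of the first-stage problem. -/
noncomputable def optValue : EReal :=
  P.stageValue S.first (P.recourse S.first) Fin.elim0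

/-- `y` is an optimal solution of the first-stage problem. -/
def IsOptimalFirstStage (y : Dec d) : Prop :=
  y ∈ P.feasible S.first Fin.elim0 ∧
    P.objective S.first (P.recourse S.first) Fin.elim0 y = P.optValue

/-- The optimal value of the approximate first-stage problem, with `𝒬_{n_1}^k` in place of the
recourse function. -/
noncomputable def approxOptValue (I : Iterates S d) (k : ℕ) : EReal :=
  P.stageValue S.first (I.approx k S.first) Fin.elim0

/-! ### The standing assumption -/

/-- The product `𝒳_1 × ⋯ × 𝒳_t`. -/
def prodX (t : ℕ) : Set (Hist d t) := {z | ∀ i : Fin t, z i ∈ P.X (i + 1)}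

/-- The fattening `[𝒳_1 × ⋯ × 𝒳_t]^ε` for the Euclidean norm of `ℝ^(d t)`. -/
def fatX (t : ℕ) (ε : ℝ) : Set (Hist d t) :=
  {z | ∃ w ∈ P.prodX t, ∑ i, ‖z i - w i‖ ^ 2 ≤ ε ^ 2}

/-- Assumption (H2) for the stage `t + 1`. -/
structure H2At (t : ℕ) : Prop where
  X_nonempty : (P.X (t + 1)).Nonempty
  X_convex : Convex ℝ (P.X (t + 1))
  X_compact : IsCompact (P.X (t + 1))
  f_measurable : ∀ z : Hist d (t + 1), Measurable (P.f (t + 1) z)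
  f_ne_bot : ∀ (m : S.Node (t + 1)) (z : Hist d (t + 1)), P.f (t + 1) z (P.Ψ m) ≠ ⊥
  f_proper : ∀ m : S.Node (t + 1), ∃ z : Hist d (t + 1), P.f (t + 1) z (P.Ψ m) ≠ ⊤
  f_convex : ∀ m : S.Node (t + 1), EConvex fun z => P.f (t + 1) z (P.Ψ m)
  f_lsc : ∀ m : S.Node (t + 1), LowerSemicontinuous fun z => P.f (t + 1) z (P.Ψ m)
  g_ne_bot : ∀ (m : S.Node (t + 1)) (i : Fin (P.r (t + 1))) (z : Hist d (t + 1)),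
    P.g (t + 1) P.x₀ z (P.Ψ m) i ≠ ⊥
  g_convex : ∀ (m : S.Node (t + 1)) (i : Fin (P.r (t + 1))),
    EConvex fun z => P.g (t + 1) P.x₀ z (P.Ψ m) i
  g_lsc : ∀ (m : S.Node (t + 1)) (i : Fin (P.r (t + 1))),
    LowerSemicontinuous fun z => P.g (t + 1) P.x₀ z (P.Ψ m) i
  fat : ∃ ε : ℝ, 0 < ε ∧ ∀ m : S.Node (t + 1), ∀ z ∈ P.fatX t ε,
    (∀ y ∈ P.X (t + 1), P.f (t + 1) (Hist.snoc z y) (P.Ψ m) < ⊤) ∧ (P.feasible m z).Nonempty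
  slater : 1 ≤ t → ∀ m : S.Node (t + 1), ∃ z ∈ P.prodX t,
    ∃ y ∈ intrinsicInterior ℝ (P.X (t + 1)),
      Hist.snoc z y ∈ intrinsicInterior ℝ
        {u : Hist d (t + 1) | ∀ i, P.g (t + 1) P.x₀ u (P.Ψ m) i ≤ 0} ∧
      y ∈ P.feasible m z

/-- Assumption (H2), for the stages `1, …, T`. -/
def H2 : Prop := ∀ t : ℕ, t < T → P.H2At t

/-! ### The algorithm -/

/-- `I` is a run of the algorithm when the scenario sampled at iteration `k ≥ 1` is `s k`. -/
structure IsRun (s : ℕ → S.Scenario) (I : Iterates S d) : Prop where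
  /-- initially the approximate recourse functions are `-∞`, except at the leaves -/
  init : ∀ t : ℕ, 1 ≤ t → t < T → ∀ n : S.Node t, I.θ 0 n = ⊥ ∧ I.β 0 n = 0
  /-- at the leaves they vanish in every iteration -/
  leaf : ∀ (k : ℕ) (n : S.Node T), I.θ k n = 0 ∧ I.β k n = 0
  /-- `x_m^k` is an optimal solution of the approximate problem of the node `m` -/
  decision : ∀ k : ℕ, 1 ≤ k → ∀ t : ℕ, t < T → ∀ m : S.Node (t + 1),
    I.x k m ∈ P.feasible m (I.hist k (S.parent m)) ∧
    P.objective m (I.approx (k - 1) m) (I.hist k (S.parent m)) (I.x k m)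
      = P.stageValue m (I.approx (k - 1) m) (I.hist k (S.parent m))
  /-- at nodes off the sampled scenario the cut is one of the current approximation -/
  unsampled : ∀ k : ℕ, 1 ≤ k → ∀ (t : ℕ) (_ : 1 ≤ t) (ht : t < T) (n : S.Node t),
    n ≠ (s k).node t ht.le →
      I.θ k n = I.approx (k - 1) n (I.hist k n) ∧
      IsSubgradientAt (I.approx (k - 1) n) (I.hist k n) (I.β k n)
  /-- at nodes of the sampled scenario a new cut is computed from subgradients `π m` of the
  approximate optimal values at the children and from a maximizing density `p` -/
  sampled : ∀ k : ℕ, 1 ≤ k → ∀ (t : ℕ) (_ : 1 ≤ t) (ht : t < T) (n : S.Node t),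
    n = (s k).node t ht.le →
      ∃ (π : S.Child n → Hist d t) (p : S.Child n → ℝ),
        (∀ m : S.Child n,
          IsSubgradientAt (P.stageValue m.1 (I.approx (k - 1) m.1)) (I.hist k n) (π m)) ∧
        p ∈ P.dualSet n ∧
        I.θ k n = dualRisk (fun m : S.Child n => S.Φ m.1) (P.dualSet n)
          (fun m => P.stageValue m.1 (I.approx (k - 1) m.1) (I.hist k n)) ∧
        I.θ k n = weightedCost (fun m : S.Child n => S.Φ m.1) p
          (fun m => P.stageValue m.1 (I.approx (k - 1) m.1) (I.hist k n)) ∧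
        I.β k n = ∑ m : S.Child n, (p m * S.Φ m.1) • π m

/-- The random iterates `I` are generated by the algorithm from the random scenarios `s`: each
realization is a run, and the only randomness is that of the samples, in the order in which the
algorithm uses them. The decisions of iteration `k` are taken before its scenario is known. -/
structure IsGenerated {Ω : Type*} (s : ℕ → Ω → S.Scenario) (I : Ω → Iterates S d) : Prop where
  run : ∀ ω : Ω, P.IsRun (fun k => s k ω) (I ω)
  decision_nonanticipative : ∀ k : ℕ, 1 ≤ k → ∀ ω ω' : Ω,
    (∀ j : ℕ, 1 ≤ j → j < k → s j ω = s j ω') →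
      ∀ (t : ℕ) (n : S.Node (t + 1)), (I ω).x k n = (I ω').x k n
  cut_nonanticipative : ∀ k : ℕ, 1 ≤ k → ∀ ω ω' : Ω,
    (∀ j : ℕ, 1 ≤ j → j ≤ k → s j ω = s j ω') →
      ∀ (t : ℕ) (n : S.Node (t + 1)), (I ω).θ k n = (I ω').θ k n ∧ (I ω).β k n = (I ω').β k n

end StochasticProgram

/-! ### Extended reals -/

/-! Every cut is a global minorant of the recourse function (`cut_le_recourse`), so only the
opposite inequality is at stake. The quantity to control is the error at node `n` before the cut of
iteration `k`, that is, $\mathcal Q_n-\mathcal Q_n^{k-1}$ at $x_{[n]}^k$. `ErrorLE` says that it is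
at most `e`, and backward induction on the stage shows that this holds eventually for every `e > 0`.
At the leaves both functions vanish.

Suppose the errors at the children of `n` are eventually small. If `n` is sampled at iteration `k`,
the new cut is almost exact at the current history. Near the compact product of the decision sets
$\mathcal Q_n$ is finite, convex, hence continuous, and bounded (`exists_real_recourse`). A minorant
that is almost exact at a point of the product therefore has a slope bounded independently of `k`,
and the cut stays almost exact on a ball of fixed radius. A later history with a large error must
lie outside that ball. Hence the histories at which `n` is sampled with a large error are separated,
and by compactness there are finitely many of them (`errorLE_of_sampled`).

Iterations that do not sample `n` are handled by probability. A large error at iteration `k` is an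
event determined by the earlier scenarios, while the scenario of iteration `k` is independent of
them and passes through `n` with a fixed positive probability. By Lévy's conditional Borel–Cantelli
lemma, infinitely many large errors would almost surely include infinitely many at which `n` is
sampled (`ae_frequently_and_of_iIndepFun`), which is excluded.

The error at the first-stage decision bounds the gap between the exact and the approximate optimal
values. Accumulation points are then optimal by closedness of the feasible set and semicontinuity of
the objective. -/

theorem EReal.exists_coe_of_ne {x : EReal} (hb : x ≠ ⊥) (ht : x ≠ ⊤) : ∃ r : ℝ, x = r :=
  ⟨x.toReal, (EReal.coe_toReal ht hb).symm⟩

theorem EReal.coe_sum_real {ι : Type*} (s : Finset ι) (u : ι → ℝ) :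
    ((∑ i ∈ s, u i : ℝ) : EReal) = ∑ i ∈ s, (u i : EReal) := by
  classical
  induction s using Finset.induction_on with
  | empty => simp
  | insert a s ha ih => rw [Finset.sum_insert ha, Finset.sum_insert ha, EReal.coe_add, ih]

theorem EReal.le_coe_of_forall_pos {x : EReal} {a : ℝ}
    (h : ∀ e : ℝ, 0 < e → x ≤ ((a + e : ℝ) : EReal)) : x ≤ a := by
  rw [← EReal.le_of_forall_lt_iff_le]
  intro z hz
  have hz' : a < z := EReal.coe_lt_coe_iff.1 hz
  simpa using h (z - a) (by linarith)

/-- A real summand cannot create ∞ − ∞, so distributivity survives for every sign of `c`. This lets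
affine cuts be handled while approximations are still −∞. -/
theorem EReal.coe_mul_add_coe (c a : ℝ) (x : EReal) :
    (c : EReal) * (x + a) = c * x + ((c * a : ℝ) : EReal) := by
  induction x using EReal.rec with
  | bot =>
    rcases lt_trichotomy c 0 with hc | hc | hc
    · rw [EReal.bot_add, EReal.coe_mul_bot_of_neg hc, EReal.top_add_coe]
    · simp [hc]
    · simp [EReal.coe_mul_bot_of_pos hc]
  | top =>
    rcases lt_trichotomy c 0 with hc | hc | hc
    · simp [EReal.coe_mul_top_of_neg hc]
    · simp [hc]
    · rw [EReal.top_add_coe, EReal.coe_mul_top_of_pos hc, EReal.top_add_coe]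
  | coe r => norm_cast; ring

theorem EReal.exists_add_le {x y : EReal} {a : ℝ} (hx : x ≠ ⊥) (hy : y ≠ ⊥)
    (h : x + y ≤ a) : ∃ u v : ℝ, x = u ∧ y = v ∧ u + v ≤ a := by
  have hxt : x ≠ ⊤ := by
    rintro rfl
    rw [EReal.top_add_of_ne_bot hy] at h
    exact absurd h (by simp)
  have hyt : y ≠ ⊤ := by
    rintro rfl
    rw [EReal.add_top_of_ne_bot hx] at h
    exact absurd h (by simp)
  obtain ⟨u, rfl⟩ := EReal.exists_coe_of_ne hx hxt
  obtain ⟨v, rfl⟩ := EReal.exists_coe_of_ne hy hyt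
  exact ⟨u, v, rfl, rfl, by exact_mod_cast h⟩

/-! ### Convexity of extended-real-valued functions -/

namespace EConvex

variable {V : Type*} [AddCommGroup V] [Module ℝ V]

/-- Real upper bounds in place of the values avoid undefined combinations of infinities. -/
theorem iff_forall {F : V → EReal} : EConvex F ↔
    ∀ (x y : V) (a b s t : ℝ), 0 ≤ s → 0 ≤ t → s + t = 1 → F x ≤ a → F y ≤ b →
      F (s • x + t • y) ≤ ((s * a + t * b : ℝ) : EReal) := by
  constructor
  · intro h x y a b s t hs ht hst hx hy
    have := h (x := (x, a)) hx (y := (y, b)) hy hs ht hst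
    simpa using this
  · rintro h ⟨x, a⟩ hx ⟨y, b⟩ hy s t hs ht hst
    simpa using h x y a b s t hs ht hst hx hy

theorem zero : EConvex (fun _ : V => (0 : EReal)) := by
  rw [iff_forall]
  intro x y a b s t hs ht _ hx hy
  have ha : (0 : ℝ) ≤ a := by exact_mod_cast hx
  have hb : (0 : ℝ) ≤ b := by exact_mod_cast hy
  have : 0 ≤ s * a + t * b := by positivity
  exact_mod_cast this

theorem add {F G : V → EReal} (hF : EConvex F) (hG : EConvex G) (hFb : ∀ x, F x ≠ ⊥)
    (hGb : ∀ x, G x ≠ ⊥) : EConvex (fun x => F x + G x) := by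
  rw [iff_forall] at *
  intro x y a b s t hs ht hst hx hy
  obtain ⟨u, v, hu, hv, huv⟩ := EReal.exists_add_le (hFb x) (hGb x) hx
  obtain ⟨u', v', hu', hv', huv'⟩ := EReal.exists_add_le (hFb y) (hGb y) hy
  refine (add_le_add (hF x y u u' s t hs ht hst hu.le hu'.le)
    (hG x y v v' s t hs ht hst hv.le hv'.le)).trans ?_
  rw [← EReal.coe_add, EReal.coe_le_coe_iff]
  nlinarith [mul_le_mul_of_nonneg_left huv hs, mul_le_mul_of_nonneg_left huv' ht]

theorem const_mul {F : V → EReal} (hF : EConvex F) {c : ℝ} (hc : 0 ≤ c) :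
    EConvex (fun x => (c : EReal) * F x) := by
  rcases hc.eq_or_lt with rfl | hc
  · simpa using zero
  have key : ∀ (z : EReal) (a : ℝ), (c : EReal) * z ≤ a ↔ z ≤ ((a / c : ℝ) : EReal) := by
    intro z a
    induction z using EReal.rec with
    | bot => simp [EReal.coe_mul_bot_of_pos hc]
    | top => simp [EReal.coe_mul_top_of_pos hc]
    | coe r => norm_cast; rw [le_div_iff₀ hc, mul_comm]
  rw [iff_forall] at *
  intro x y a b s t hs ht hst hx hy
  rw [key] at *
  refine (hF x y _ _ s t hs ht hst hx hy).trans_eq ?_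
  congr 1
  ring

theorem sum {ι : Type*} (A : Finset ι) {F : ι → V → EReal} (hF : ∀ i ∈ A, EConvex (F i))
    (hb : ∀ i ∈ A, ∀ x, F i x ≠ ⊥) :
    EConvex (fun x => ∑ i ∈ A, F i x) ∧ ∀ x, ∑ i ∈ A, F i x ≠ ⊥ := by
  classical
  induction A using Finset.induction_on with
  | empty => simpa using zero
  | insert a A ha ih =>
    obtain ⟨h1, h2⟩ := ih (fun i hi => hF i (Finset.mem_insert_of_mem hi))
      (fun i hi => hb i (Finset.mem_insert_of_mem hi))
    simp only [Finset.sum_insert ha]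
    have h3 := hb a (Finset.mem_insert_self _ _)
    refine ⟨(hF a (Finset.mem_insert_self _ _)).add h1 h3 h2, fun x => ?_⟩
    simp [EReal.add_eq_bot_iff, h2 x, h3 x]

theorem iSup₂ {ι : Type*} {A : Set ι} {F : ι → V → EReal} (hF : ∀ i ∈ A, EConvex (F i)) :
    EConvex (fun x => ⨆ i ∈ A, F i x) := by
  rw [iff_forall]
  intro x y a b s t hs ht hst hx hy
  refine iSup₂_le fun i hi => ?_
  exact iff_forall.1 (hF i hi) x y a b s t hs ht hst
    ((le_iSup₂ (f := fun i (_ : i ∈ A) => F i x) i hi).trans hx)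
    ((le_iSup₂ (f := fun i (_ : i ∈ A) => F i y) i hi).trans hy)

/-- The real part of a convex function is convex on a convex set on which the function is finite. -/
theorem convexOn_toReal {F : V → EReal} (hF : EConvex F) {U : Set V} (hU : Convex ℝ U)
    (hb : ∀ x, F x ≠ ⊥) (ht : ∀ x ∈ U, F x ≠ ⊤) : ConvexOn ℝ U (fun x => (F x).toReal) := by
  refine ⟨hU, fun x hx y hy s t hs ht' hst => ?_⟩
  have h := iff_forall.1 hF x y (F x).toReal (F y).toReal s t hs ht' hst
    (EReal.coe_toReal (ht x hx) (hb x)).ge (EReal.coe_toReal (ht y hy) (hb y)).ge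
  have h2 := EReal.coe_toReal (ht _ (hU hx hy hs ht' hst)) (hb _)
  rw [← h2] at h
  simpa using EReal.coe_le_coe_iff.1 h

end EConvex

/-! ### Dual sets and risks of extended-real costs -/

section Risk

variable {ι : Type*} [Fintype ι] {w : ι → ℝ} {ρ : (ι → ℝ) → ℝ} {D : Set (ι → ℝ)}

theorem IsDualSet.nonempty (h : IsDualSet w ρ D) : D.Nonempty := by
  by_contra hempty
  rw [Set.not_nonempty_iff_eq_empty] at hempty
  have hb := (h.isLUB 0).2 (show ρ 0 - 1 ∈ upperBounds _ by simp [hempty])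
  linarith

theorem weightedCost_mono {p : ι → ℝ} (hp : ∀ i, 0 ≤ p i * w i) {Z W : ι → EReal}
    (h : ∀ i, Z i ≤ W i) : weightedCost w p Z ≤ weightedCost w p W :=
  Finset.sum_le_sum fun i _ => mul_le_mul_of_nonneg_left (h i) (by exact_mod_cast hp i)

theorem weightedCost_add_coe (p : ι → ℝ) (Z : ι → EReal) (a : ι → ℝ) :
    weightedCost w p (fun i => Z i + (a i : EReal))
      = weightedCost w p Z + ((∑ i, p i * w i * a i : ℝ) : EReal) := by
  simp only [weightedCost, EReal.coe_mul_add_coe, Finset.sum_add_distrib, EReal.coe_sum_real]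

theorem IsDualSet.weight_nonneg (h : IsDualSet w ρ D) (hw : ∀ i, 0 ≤ w i) {p : ι → ℝ}
    (hp : p ∈ D) (i : ι) : 0 ≤ p i * w i :=
  mul_nonneg ((h.density hp).1 i) (hw i)

theorem IsDualSet.dualRisk_mono (h : IsDualSet w ρ D) (hw : ∀ i, 0 ≤ w i) {Z W : ι → EReal}
    (hZ : ∀ i, Z i ≤ W i) : dualRisk w D Z ≤ dualRisk w D W :=
  iSup₂_mono fun _ hp => weightedCost_mono (h.weight_nonneg hw hp) hZ

/-- The densities have total mass one, so a constant shift passes through each weighted cost,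
infinite costs included. -/
theorem IsDualSet.dualRisk_le_add (h : IsDualSet w ρ D) (hw : ∀ i, 0 ≤ w i) {Z W : ι → EReal}
    {e : ℝ} (hZ : ∀ i, Z i ≤ W i + (e : EReal)) : dualRisk w D Z ≤ dualRisk w D W + (e : EReal) := by
  refine iSup₂_le fun p hp => ?_
  refine (weightedCost_mono (h.weight_nonneg hw hp) hZ).trans ?_
  rw [weightedCost_add_coe, ← Finset.sum_mul, (h.density hp).2, one_mul]
  gcongr
  exact le_iSup₂ (f := fun (p : ι → ℝ) (_ : p ∈ D) => weightedCost w p W) p hp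

theorem IsDualSet.coe_le_dualRisk (h : IsDualSet w ρ D) (hw : ∀ i, 0 ≤ w i) {Z : ι → EReal}
    {c : ℝ} (hZ : ∀ i, (c : EReal) ≤ Z i) : (c : EReal) ≤ dualRisk w D Z := by
  obtain ⟨p, hp⟩ := h.nonempty
  refine le_trans ?_ (le_iSup₂ (f := fun (p : ι → ℝ) (_ : p ∈ D) => weightedCost w p Z) p hp)
  refine le_trans (le_of_eq ?_) (weightedCost_mono (h.weight_nonneg hw hp) hZ)
  simp only [weightedCost, ← EReal.coe_mul, ← EReal.coe_sum_real]
  rw [← Finset.sum_mul, (h.density hp).2, one_mul]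

/-- For real costs the risk is a value of the real-valued `ρ`; this replaces any boundedness of `D`.
-/
theorem IsDualSet.dualRisk_ne_top (h : IsDualSet w ρ D) {Z : ι → EReal}
    (hb : ∀ i, Z i ≠ ⊥) (ht : ∀ i, Z i ≠ ⊤) : dualRisk w D Z ≠ ⊤ := by
  choose z hz using fun i => EReal.exists_coe_of_ne (hb i) (ht i)
  rw [show Z = fun i => (z i : EReal) from funext hz, h.dualRisk_coe]
  exact EReal.coe_ne_top _

theorem IsDualSet.econvex_dualRisk {V : Type*} [AddCommGroup V] [Module ℝ V]
    (h : IsDualSet w ρ D) (hw : ∀ i, 0 ≤ w i) {Z : ι → V → EReal} (hZ : ∀ i, EConvex (Z i))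
    (hb : ∀ i x, Z i x ≠ ⊥) : EConvex (fun x => dualRisk w D (fun i => Z i x)) := by
  refine EConvex.iSup₂ fun p hp => ?_
  refine (EConvex.sum Finset.univ
    (fun i _ => (hZ i).const_mul (h.weight_nonneg hw hp i)) fun i _ x => ?_).1
  rcases (h.weight_nonneg hw hp i).eq_or_lt with h0 | h0
  · simp [← h0]
  · intro hbot
    rcases EReal.mul_eq_bot _ _ |>.1 hbot with h' | h' | h' | h'
    · exact EReal.coe_ne_bot _ h'.1
    · exact hb i x h'.2
    · exact EReal.coe_ne_top _ h'.1
    · exact absurd h'.1 (not_lt.2 (by exact_mod_cast h0.le))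

end Risk

/-! ### Histories -/

namespace Hist

variable {d t : ℕ}

@[simp] theorem snoc_castSucc (x : Hist d t) (y : Dec d) (i : Fin t) :
    snoc x y i.castSucc = x i := by
  simp [snoc]

@[simp] theorem snoc_last (x : Hist d t) (y : Dec d) : snoc x y (Fin.last t) = y := by
  simp [snoc]

theorem snoc_combo (x x' : Hist d t) (y y' : Dec d) (a b : ℝ) :
    snoc (a • x + b • x') (a • y + b • y') = a • snoc x y + b • snoc x' y' := by
  funext i
  refine Fin.lastCases ?_ (fun i => ?_) i <;> simp

theorem norm_snoc_le {x : Hist d t} {y : Dec d} {R : ℝ} (hx : ‖x‖ ≤ R) (hy : ‖y‖ ≤ R) :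
    ‖snoc x y‖ ≤ R := by
  refine (pi_norm_le_iff_of_nonneg ((norm_nonneg _).trans hx)).2 fun i => ?_
  refine Fin.lastCases ?_ (fun i => ?_) i
  · simpa using hy
  · simpa using (norm_le_pi_norm x i).trans hx

theorem continuous_snoc (x : Hist d t) : Continuous (snoc x) := by
  refine continuous_pi fun i => ?_
  refine Fin.lastCases ?_ (fun i => ?_) i
  · simpa using continuous_id'
  · simpa using continuous_const

theorem dot_smul (x y : Hist d t) (a : ℝ) : dot x (a • y) = a * dot x y := by
  simp [dot, inner_smul_right, Finset.mul_sum]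

theorem dot_sum_smul {ι : Type*} (A : Finset ι) (c : ι → ℝ) (u : ι → Hist d t) (y : Hist d t) :
    dot (∑ i ∈ A, c i • u i) y = ∑ i ∈ A, c i * dot (u i) y := by
  simp only [dot, Finset.sum_apply, sum_inner, Pi.smul_apply, real_inner_smul_left, Finset.mul_sum]
  exact Finset.sum_comm

@[simp] theorem dot_zero_right (x : Hist d t) : dot x 0 = 0 := by simp [dot]

@[simp] theorem dot_zero_left (x : Hist d t) : dot 0 x = 0 := by simp [dot]

/-- A linear functional bounded above on a ball is bounded below by a multiple of the norm. -/
theorem neg_mul_norm_le_dot {u : Hist d t} {M δ : ℝ} (hδ : 0 < δ)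
    (h : ∀ v : Hist d t, ‖v‖ ≤ δ → dot u v ≤ M) (v : Hist d t) : -(M / δ) * ‖v‖ ≤ dot u v := by
  rcases eq_or_ne v 0 with rfl | hv
  · simp
  have hv' : 0 < ‖v‖ := norm_pos_iff.2 hv
  -- The bound is tested at the vector of norm `δ` opposite to `v`.
  have h1 := h ((-(δ / ‖v‖)) • v) (by
    rw [norm_smul, norm_neg, norm_div, norm_norm, Real.norm_of_nonneg hδ.le,
      div_mul_cancel₀ _ hv'.ne'])
  rw [dot_smul] at h1
  have h2 : δ / ‖v‖ * dot u v * (‖v‖ / δ) = dot u v := by field_simp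
  have h3 : 0 ≤ ‖v‖ / δ := by positivity
  have h4 := mul_le_mul_of_nonneg_right (show -M ≤ δ / ‖v‖ * dot u v by linarith) h3
  rw [h2] at h4
  calc -(M / δ) * ‖v‖ = -M * (‖v‖ / δ) := by ring
    _ ≤ _ := h4

end Hist

namespace StochasticProgram

variable {T : ℕ} {S : ScenarioTree T} {d K : ℕ} (P : StochasticProgram S d K)

/-! ### The value of a stage problem -/

section Stage

variable {P} {t : ℕ}

theorem stageValue_mono (m : S.Node (t + 1)) {V W : Hist d (t + 1) → EReal} (h : V ≤ W)
    (x : Hist d t) : P.stageValue m V x ≤ P.stageValue m W x :=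
  iInf₂_mono fun _ _ => add_le_add le_rfl (h _)

/-- The graph of the feasible map is convex: the constraints are convex or affine jointly in `(x,
y)`, and the fixed `x₀` is reproduced because the weights sum to one. -/
theorem feasible_combo (H : P.H2At t) (m : S.Node (t + 1)) {x x' : Hist d t} {y y' : Dec d}
    (hy : y ∈ P.feasible m x) (hy' : y' ∈ P.feasible m x') {a b : ℝ} (ha : 0 ≤ a) (hb : 0 ≤ b)
    (hab : a + b = 1) : a • y + b • y' ∈ P.feasible m (a • x + b • x') := by
  refine ⟨H.X_convex hy.1 hy'.1 ha hb hab, fun i => ?_, ?_⟩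
  · rw [Hist.snoc_combo]
    simpa using EConvex.iff_forall.1 (H.g_convex m i) (Hist.snoc x y) (Hist.snoc x' y') 0 0 a b
      ha hb hab (hy.2.1 i) (hy'.2.1 i)
  · have key : ∀ τ : Fin (t + 2), (Fin.cons (α := fun _ => Dec d) P.x₀
        (Hist.snoc (a • x + b • x') (a • y + b • y')) τ).ofLp
        = a • (Fin.cons (α := fun _ => Dec d) P.x₀ (Hist.snoc x y) τ).ofLp
          + b • (Fin.cons (α := fun _ => Dec d) P.x₀ (Hist.snoc x' y') τ).ofLp := by
      intro τ
      refine Fin.cases ?_ (fun i => ?_) τ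
      · simp [← add_smul, hab]
      · simp [Hist.snoc_combo]
    simp only [key, Matrix.mulVec_add, Matrix.mulVec_smul, Finset.sum_add_distrib,
      ← Finset.smul_sum]
    rw [hy.2.2, hy'.2.2, ← add_smul, hab, one_smul]

/-- Partial minimization of a jointly convex function over a convex graph is convex. Decisions
optimal up to `e` suffice, so no attainment is needed. -/
theorem econvex_stageValue (H : P.H2At t) (m : S.Node (t + 1)) {V : Hist d (t + 1) → EReal}
    (hV : EConvex V) (hb : ∀ z, V z ≠ ⊥) : EConvex (P.stageValue m V) := by
  have hF := (H.f_convex m).add hV (H.f_ne_bot m) hb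
  rw [EConvex.iff_forall] at hF ⊢
  intro x x' a a' s s' hs hs' hss hx hx'
  refine EReal.le_coe_of_forall_pos fun e he => ?_
  have hlt : ∀ {z : Hist d t} {c : ℝ}, P.stageValue m V z ≤ c →
      ∃ y ∈ P.feasible m z, P.objective m V z y ≤ ((c + e : ℝ) : EReal) := by
    intro z c hz
    have h1 : P.stageValue m V z < ((c + e : ℝ) : EReal) :=
      hz.trans_lt (EReal.coe_lt_coe_iff.2 (by linarith))
    simp only [stageValue, iInf_lt_iff] at h1
    obtain ⟨y, hy, h2⟩ := h1
    exact ⟨y, hy, h2.le⟩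
  obtain ⟨y, hy, h1⟩ := hlt hx
  obtain ⟨y', hy', h1'⟩ := hlt hx'
  refine (iInf₂_le (f := fun y (_ : y ∈ P.feasible m (s • x + s' • x')) =>
    P.objective m V (s • x + s' • x') y) _ (feasible_combo H m hy hy' hs hs' hss)).trans ?_
  have h2 := hF _ _ _ _ s s' hs hs' hss h1 h1'
  rw [← Hist.snoc_combo] at h2
  refine h2.trans (EReal.coe_le_coe_iff.2 ?_)
  nlinarith

/-- A stage problem has a value bounded below on bounded sets if the cost of the later stages has. -/
theorem exists_coe_le_stageValue (H : P.H2At t) (m : S.Node (t + 1)) {V : Hist d (t + 1) → EReal}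
    (hV : ∀ R : ℝ, ∃ c : ℝ, ∀ z, ‖z‖ ≤ R → (c : EReal) ≤ V z) (R : ℝ) :
    ∃ c : ℝ, ∀ x, ‖x‖ ≤ R → (c : EReal) ≤ P.stageValue m V x := by
  obtain ⟨B, hB⟩ := H.X_compact.isBounded.exists_norm_le
  -- The radius covers the histories and the decisions; the 0 keeps the ball nonempty, so that the
  -- semicontinuous `f` has a minimum on it.
  set R' := max (max R B) 0
  obtain ⟨c, hc⟩ := hV R'
  obtain ⟨z₀, -, hz₀⟩ := LowerSemicontinuousOn.exists_isMinOn
    (s := Metric.closedBall (0 : Hist d (t + 1)) R') ⟨0, by simp [R']⟩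
    (isCompact_closedBall _ _) ((H.f_lsc m).lowerSemicontinuousOn _)
  obtain ⟨c', hc'⟩ : ∃ c' : ℝ, ∀ z : Hist d (t + 1), ‖z‖ ≤ R' →
      (c' : EReal) ≤ P.f (t + 1) z (P.Ψ m) := by
    by_cases htop : P.f (t + 1) z₀ (P.Ψ m) = ⊤
    · refine ⟨0, fun z hz => ?_⟩
      have := hz₀ (show z ∈ Metric.closedBall _ _ by simpa using hz)
      simp only [Set.mem_ofPred_eq, htop, top_le_iff] at this
      simp [this]
    · obtain ⟨r, hr⟩ := EReal.exists_coe_of_ne (H.f_ne_bot m z₀) htop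
      refine ⟨r, fun z hz => ?_⟩
      have := hz₀ (show z ∈ Metric.closedBall _ _ by simpa using hz)
      simpa only [Set.mem_ofPred_eq, hr] using this
  refine ⟨c' + c, fun x hx => le_iInf₂ fun y hy => ?_⟩
  have hn : ‖Hist.snoc x y‖ ≤ R' := Hist.norm_snoc_le
    (hx.trans ((le_max_left _ _).trans (le_max_left _ _)))
    ((hB y hy.1).trans ((le_max_right _ _).trans (le_max_left _ _)))
  rw [EReal.coe_add]
  exact add_le_add (hc' _ hn) (hc _ hn)

end Stage

/-! ### Fattenings of the products of the decision sets -/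

theorem fatX_mono (t : ℕ) {ε ε' : ℝ} (h0 : 0 ≤ ε) (h : ε ≤ ε') : P.fatX t ε ⊆ P.fatX t ε' := by
  rintro z ⟨w, hw, hz⟩
  exact ⟨w, hw, hz.trans (by gcongr)⟩

variable {P}

theorem snoc_mem_prodX {t : ℕ} {z : Hist d t} (hz : z ∈ P.prodX t) {y : Dec d}
    (hy : y ∈ P.X (t + 1)) : Hist.snoc z y ∈ P.prodX (t + 1) := by
  intro i
  refine Fin.lastCases ?_ (fun i => ?_) i
  · simpa using hy
  · simpa using hz i

/-- The appended decision lies in its own set and adds no distance. Hence one radius serves all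
stages. -/
theorem snoc_mem_fatX {t : ℕ} {ε : ℝ} {z : Hist d t} (hz : z ∈ P.fatX t ε) {y : Dec d}
    (hy : y ∈ P.X (t + 1)) : Hist.snoc z y ∈ P.fatX (t + 1) ε := by
  obtain ⟨w, hw, hz⟩ := hz
  refine ⟨Hist.snoc w y, snoc_mem_prodX hw hy, ?_⟩
  simpa [Fin.sum_univ_castSucc] using hz

variable (P) in
-- The metric on histories is the sup metric, the fattening is Euclidean: `t` squares of size `(ε /
-- (t + 1)) ^ 2` sum to at most `ε ^ 2`.
theorem thickening_subset_fatX (t : ℕ) (ε : ℝ) :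
    Metric.thickening (ε / (t + 1)) (P.prodX t) ⊆ P.fatX t ε := by
  intro z hz
  obtain ⟨w, hw, hzw⟩ := Metric.mem_thickening_iff.1 hz
  refine ⟨w, hw, ?_⟩
  have h1 : ∀ i : Fin t, ‖z i - w i‖ ^ 2 ≤ (ε / (t + 1)) ^ 2 := by
    intro i
    gcongr
    rw [← dist_eq_norm]
    exact (dist_le_pi_dist z w i).trans hzw.le
  refine (Finset.sum_le_sum fun i _ => h1 i).trans ?_
  rw [Finset.sum_const, Finset.card_univ, Fintype.card_fin, nsmul_eq_mul, div_pow]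
  have ht : (0 : ℝ) ≤ t := Nat.cast_nonneg t
  rw [← mul_div_assoc, div_le_iff₀ (by positivity)]
  nlinarith [mul_nonneg (sq_nonneg ε) ht, mul_nonneg (sq_nonneg ε) (sq_nonneg (t : ℝ))]

theorem prodX_eq_pi (t : ℕ) : P.prodX t = Set.univ.pi fun i : Fin t => P.X (i + 1) := by
  ext z
  simp [prodX]

theorem H2.isCompact_prodX (H : P.H2) {t : ℕ} (ht : t ≤ T) : IsCompact (P.prodX t) := by
  rw [prodX_eq_pi]
  exact isCompact_univ_pi fun i => (H i (i.2.trans_le ht)).X_compact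

theorem H2.convex_prodX (H : P.H2) {t : ℕ} (ht : t ≤ T) : Convex ℝ (P.prodX t) := by
  rw [prodX_eq_pi]
  exact convex_pi fun i _ => (H i (i.2.trans_le ht)).X_convex

/-- One radius of the fattening for all stages. -/
theorem H2.exists_fat (H : P.H2) : ∃ ε : ℝ, 0 < ε ∧ ∀ t < T, ∀ m : S.Node (t + 1),
    ∀ z ∈ P.fatX t ε, (∀ y ∈ P.X (t + 1), P.f (t + 1) (Hist.snoc z y) (P.Ψ m) < ⊤) ∧
      (P.feasible m z).Nonempty := by
  suffices h : ∀ N ≤ T, ∃ ε : ℝ, 0 < ε ∧ ∀ t < N, ∀ m : S.Node (t + 1),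
      ∀ z ∈ P.fatX t ε, (∀ y ∈ P.X (t + 1), P.f (t + 1) (Hist.snoc z y) (P.Ψ m) < ⊤) ∧
        (P.feasible m z).Nonempty from h T le_rfl
  intro N
  induction N with
  | zero => exact fun _ => ⟨1, one_pos, by simp⟩
  | succ N ih =>
    intro hN
    obtain ⟨ε, hε, h⟩ := ih (by omega)
    obtain ⟨ε', hε', h'⟩ := (H N (by omega)).fat
    have h0 : 0 < min ε ε' := lt_min hε hε'
    refine ⟨min ε ε', h0, fun t ht m z hz => ?_⟩
    rcases (Nat.lt_succ_iff.1 ht).eq_or_lt with rfl | ht'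
    · exact h' m z (fatX_mono P t h0.le (min_le_right _ _) hz)
    · exact h t ht' m z (fatX_mono P t h0.le (min_le_left _ _) hz)

/-! ### The recourse functions -/

theorem stageValue_ne_top {t : ℕ} {ε : ℝ} (m : S.Node (t + 1)) {V : Hist d (t + 1) → EReal}
    {z : Hist d t} (hz : z ∈ P.fatX t ε)
    (hf : (∀ y ∈ P.X (t + 1), P.f (t + 1) (Hist.snoc z y) (P.Ψ m) < ⊤) ∧
      (P.feasible m z).Nonempty) (hV : ∀ z ∈ P.fatX (t + 1) ε, V z ≠ ⊤) :
    P.stageValue m V z ≠ ⊤ := by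
  obtain ⟨hf, y, hy⟩ := hf
  have h1 := EReal.add_lt_top (hf y hy.1).ne (hV _ (snoc_mem_fatX hz hy.1))
  exact ((iInf₂_le (f := fun y (_ : y ∈ P.feasible m z) => P.objective m V z y) y hy).trans_lt
    h1).ne

theorem ne_bot_of_bounded {E : Type*} [Norm E] {V : E → EReal}
    (hV : ∀ R : ℝ, ∃ c : ℝ, ∀ z, ‖z‖ ≤ R → (c : EReal) ≤ V z) (z : E) : V z ≠ ⊥ := by
  obtain ⟨c, hc⟩ := hV ‖z‖
  intro h
  have := hc z le_rfl
  rw [h] at this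
  simp at this

theorem recourse_leaf (n : S.Node T) (x : Hist d T) : P.recourse n x = 0 := by
  simp [recourse, recourseAux]

theorem recourse_eq {t : ℕ} (ht : t < T) (n : S.Node t) (x : Hist d t) :
    P.recourse n x = dualRisk (fun m : S.Child n => S.Φ m.1) (P.dualSet n)
      (fun m : S.Child n => P.stageValue m.1 (P.recourse m.1) x) := by
  obtain ⟨j, hj⟩ : ∃ j, T - t = j + 1 := ⟨T - t - 1, by omega⟩
  have hj' : T - (t + 1) = j := by omega
  have h : ∀ m : S.Node (t + 1), P.recourse m = P.recourseAux j m := by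
    intro m
    funext z
    simp [recourse, hj']
  simp only [h]
  simp [recourse, hj, recourseAux]

/-- Backward induction carrying all three properties. The lower bound on every ball excludes −∞
everywhere, which convexity of sums and finiteness of the risk require; +∞ is excluded on the
fattening, where some feasible decision has finite cost. -/
theorem recourse_properties (hrisk : P.HasCoherentRisk) (H : P.H2) {ε : ℝ}
    (hε : ∀ t < T, ∀ m : S.Node (t + 1), ∀ z ∈ P.fatX t ε,
      (∀ y ∈ P.X (t + 1), P.f (t + 1) (Hist.snoc z y) (P.Ψ m) < ⊤) ∧ (P.feasible m z).Nonempty)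
    {t : ℕ} (h1 : 1 ≤ t) (hT : t ≤ T) (n : S.Node t) :
    EConvex (P.recourse n) ∧
      (∀ R : ℝ, ∃ c : ℝ, ∀ z, ‖z‖ ≤ R → (c : EReal) ≤ P.recourse n z) ∧
      ∀ z ∈ P.fatX t ε, P.recourse n z ≠ ⊤ := by
  induction hT using Nat.decreasingInduction with
  | self =>
    have : P.recourse n = fun _ => 0 := funext fun x => recourse_leaf n x
    rw [this]
    exact ⟨EConvex.zero, fun R => ⟨0, fun _ _ => le_rfl⟩, fun _ _ => EReal.zero_ne_top⟩
  | of_succ t ht ih =>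
    have hm := fun m : S.Child n => ih (by omega) m.1
    have hD := (hrisk t h1 ht n).2
    have hw : ∀ m : S.Child n, 0 ≤ S.Φ m.1 := fun m => (S.Φ_pos m.1).le
    have hlow := fun m : S.Child n => exists_coe_le_stageValue (H t ht) m.1 (hm m).2.1
    have hb := fun m : S.Child n => ne_bot_of_bounded (hlow m)
    refine ⟨?_, fun R => ?_, fun z hz => ?_⟩
    · rw [show P.recourse n = _ from funext fun x => recourse_eq ht n x]
      exact hD.econvex_dualRisk hw (fun m => econvex_stageValue (H t ht) m.1 (hm m).1
        (ne_bot_of_bounded (hm m).2.1)) hb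
    · choose c hc using fun m => hlow m R
      obtain ⟨c₀, hc₀⟩ := (Set.finite_range c).bddBelow
      refine ⟨c₀, fun z hz => ?_⟩
      rw [recourse_eq ht]
      refine hD.coe_le_dualRisk hw fun m => le_trans ?_ (hc m z hz)
      exact_mod_cast hc₀ ⟨m, rfl⟩
    · rw [recourse_eq ht]
      exact hD.dualRisk_ne_top (fun m => hb m z)
        fun m => stageValue_ne_top m.1 hz (hε t ht m.1 z hz) (hm m).2.2

/-- Near the product of the decision sets a recourse function is real-valued, continuous and
bounded. -/
theorem exists_real_recourse (hrisk : P.HasCoherentRisk) (H : P.H2) {t : ℕ} (h1 : 1 ≤ t)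
    (hT : t ≤ T) (n : S.Node t) : ∃ (φ : Hist d t → ℝ) (δ C : ℝ), 0 < δ ∧
      ContinuousOn φ (P.prodX t) ∧ ∀ z ∈ Metric.cthickening δ (P.prodX t),
        P.recourse n z = φ z ∧ |φ z| ≤ C := by
  obtain ⟨ε, hε, hfat⟩ := H.exists_fat
  obtain ⟨hconv, hlow, htop⟩ := recourse_properties hrisk H hfat h1 hT n
  set η := ε / (t + 1) with hη
  have hη0 : 0 < η := by positivity
  have htop' : ∀ z ∈ Metric.thickening η (P.prodX t), P.recourse n z ≠ ⊤ :=
    fun z hz => htop z (thickening_subset_fatX P t ε hz)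
  have hb := ne_bot_of_bounded hlow
  -- A finite convex function on an open subset of a finite-dimensional space is continuous.
  have hcont : ContinuousOn (fun z => (P.recourse n z).toReal)
      (Metric.thickening η (P.prodX t)) :=
    (hconv.convexOn_toReal ((H.convex_prodX hT).thickening η) hb htop').continuousOn
      Metric.isOpen_thickening
  -- Halving the radius gives a compact neighbourhood inside the open one, hence the bound `C`.
  have hsub : Metric.cthickening (η / 2) (P.prodX t) ⊆ Metric.thickening η (P.prodX t) :=
    Metric.cthickening_subset_thickening' hη0 (by linarith) _
  have hK : IsCompact (Metric.cthickening (η / 2) (P.prodX t)) :=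
    (H.isCompact_prodX hT).cthickening
  obtain ⟨C, hC⟩ := hK.exists_bound_of_continuousOn (hcont.mono hsub)
  refine ⟨fun z => (P.recourse n z).toReal, η / 2, C, by positivity,
    hcont.mono (Metric.self_subset_thickening hη0 _), fun z hz => ⟨?_, ?_⟩⟩
  · exact (EReal.coe_toReal (htop' z (hsub hz)) (hb z)).symm
  · exact hC z hz

end StochasticProgram

/-! ### Cuts -/

namespace Iterates

variable {T : ℕ} {S : ScenarioTree T} {d : ℕ} (I : Iterates S d)

theorem cut_le_approx {k l : ℕ} (h : l ≤ k) {t : ℕ} (n : S.Node t) (z : Hist d t) :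
    I.θ l n + ((Hist.dot (I.β l n) (z - I.hist l n) : ℝ) : EReal) ≤ I.approx k n z :=
  le_iSup₂ (f := fun l (_ : l ∈ Finset.range (k + 1)) =>
    I.θ l n + ((Hist.dot (I.β l n) (z - I.hist l n) : ℝ) : EReal)) l
    (Finset.mem_range.2 (by omega))

theorem approx_mono {k k' : ℕ} (h : k ≤ k') {t : ℕ} (n : S.Node t) (z : Hist d t) :
    I.approx k n z ≤ I.approx k' n z :=
  iSup₂_le fun _ hl => I.cut_le_approx ((Nat.lt_succ_iff.1 (Finset.mem_range.1 hl)).trans h) n z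

end Iterates

/-- The cut computed from subgradients of the costs of the children minorizes the risk of them. -/
theorem cut_le_dualRisk {ι : Type*} [Fintype ι] {w : ι → ℝ} {ρ : (ι → ℝ) → ℝ}
    {D : Set (ι → ℝ)} (hD : IsDualSet w ρ D) (hw : ∀ i, 0 ≤ w i) {d t : ℕ}
    {Z : ι → Hist d t → EReal} {x : Hist d t} {π : ι → Hist d t}
    (hπ : ∀ i, IsSubgradientAt (Z i) x (π i)) {p : ι → ℝ} (hp : p ∈ D) (y : Hist d t) :
    weightedCost w p (fun i => Z i x) +
      ((Hist.dot (∑ i, (p i * w i) • π i) (y - x) : ℝ) : EReal) ≤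
      dualRisk w D (fun i => Z i y) := by
  rw [Hist.dot_sum_smul, ← weightedCost_add_coe]
  exact (weightedCost_mono (hD.weight_nonneg hw hp) fun i => hπ i y).trans
    (le_iSup₂ (f := fun (p : ι → ℝ) (_ : p ∈ D) => weightedCost w p fun i => Z i y) p hp)

namespace StochasticProgram

variable {T : ℕ} {S : ScenarioTree T} {d K : ℕ} {P : StochasticProgram S d K}

theorem le_of_node {t : ℕ} (n : S.Node t) : t ≤ T := by
  by_contra h
  exact (S.isEmpty_of_lt t (by omega)).false n

namespace IsRun

variable {s : ℕ → S.Scenario} {I : Iterates S d}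

theorem hist_mem_prodX (hI : P.IsRun s I) {k : ℕ} (hk : 1 ≤ k) {t : ℕ} (n : S.Node t) :
    I.hist k n ∈ P.prodX t := by
  induction t with
  | zero => exact fun i => i.elim0
  | succ t ih =>
    exact snoc_mem_prodX (ih (S.parent n)) (hI.decision k hk t (le_of_node n) n).1.1

theorem approx_leaf (hI : P.IsRun s I) (k : ℕ) (n : S.Node T) (z : Hist d T) :
    I.approx k n z = 0 := by
  refine le_antisymm (iSup₂_le fun l _ => ?_) ?_
  · simp [hI.leaf l n]
  · simpa [hI.leaf 0 n] using I.cut_le_approx (Nat.zero_le k) n z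

/-- Strong induction on `k` for all nodes at once: a cut of iteration `k` is built from
approximations of index `k - 1`, at the children or at the node itself, and the recursion is
monotone. -/
theorem cut_le_recourse (hrisk : P.HasCoherentRisk) (hI : P.IsRun s I) (k : ℕ) {t : ℕ}
    (ht : 1 ≤ t) (n : S.Node t) (z : Hist d t) :
    I.θ k n + ((Hist.dot (I.β k n) (z - I.hist k n) : ℝ) : EReal) ≤ P.recourse n z := by
  induction k using Nat.strong_induction_on generalizing t with
  | _ k ih =>
  have happ : ∀ {t' : ℕ}, 1 ≤ t' → 1 ≤ k → ∀ (m : S.Node t') (z : Hist d t'),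
      I.approx (k - 1) m z ≤ P.recourse m z := fun ht' hk m z =>
    iSup₂_le fun l hl => ih l (by have := Finset.mem_range.1 hl; omega) ht' m z
  rcases (le_of_node n).eq_or_lt with rfl | htT
  · simp [hI.leaf k n, recourse_leaf]
  rcases Nat.eq_zero_or_pos k with rfl | hk
  · simp [hI.init t ht htT n]
  by_cases hn : n = (s k).node t htT.le
  · obtain ⟨π, p, hπ, hp, -, hθ, hβ⟩ := hI.sampled k hk t ht htT n hn
    have hD := (hrisk t ht htT n).2
    have hw : ∀ m : S.Child n, 0 ≤ S.Φ m.1 := fun m => (S.Φ_pos m.1).le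
    rw [hθ, hβ, recourse_eq htT]
    exact (cut_le_dualRisk hD hw hπ hp z).trans
      (hD.dualRisk_mono hw fun m => stageValue_mono m.1 (happ (by omega) hk m.1) z)
  · obtain ⟨hθ, hβ⟩ := hI.unsampled k hk t ht htT n hn
    rw [hθ]
    exact (hβ z).trans (happ ht hk n z)

theorem approx_le_recourse (hrisk : P.HasCoherentRisk) (hI : P.IsRun s I) (k : ℕ) {t : ℕ}
    (ht : 1 ≤ t) (n : S.Node t) (z : Hist d t) : I.approx k n z ≤ P.recourse n z :=
  iSup₂_le fun l _ => hI.cut_le_recourse hrisk l ht n z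

/-- Errors at the decisions computed bound the errors of the optimal values. -/
theorem stageValue_recourse_le_add (hI : P.IsRun s I) {k : ℕ} (hk : 1 ≤ k) {t : ℕ}
    (m : S.Node (t + 1)) {e : ℝ}
    (he : P.recourse m (I.hist k m) ≤ I.approx (k - 1) m (I.hist k m) + (e : EReal)) :
    P.stageValue m (P.recourse m) (I.hist k (S.parent m)) ≤
      P.stageValue m (I.approx (k - 1) m) (I.hist k (S.parent m)) + (e : EReal) := by
  obtain ⟨hf, hv⟩ := hI.decision k hk t (le_of_node m) m
  -- The computed decision is feasible for the exact problem too, so the error matters at this one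
  -- point only.
  rw [← hv]
  refine (iInf₂_le (f := fun y (_ : y ∈ P.feasible m (I.hist k (S.parent m))) =>
    P.objective m (P.recourse m) (I.hist k (S.parent m)) y) _ hf).trans ?_
  rw [objective, objective, add_assoc]
  exact add_le_add le_rfl he

/-- At a sampled node the value of the new cut is almost the recourse function, if the recourse
functions of the children are approximated well. -/
theorem recourse_le_theta_add (hrisk : P.HasCoherentRisk) (hI : P.IsRun s I) {k : ℕ} (hk : 1 ≤ k)
    {t : ℕ} (ht : 1 ≤ t) (htT : t < T) {n : S.Node t} (hn : n = (s k).node t htT.le) {e : ℝ}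
    (he : ∀ m : S.Child n,
      P.recourse m.1 (I.hist k m.1) ≤ I.approx (k - 1) m.1 (I.hist k m.1) + (e : EReal)) :
    P.recourse n (I.hist k n) ≤ I.θ k n + (e : EReal) := by
  obtain ⟨π, p, -, -, hθ, -, -⟩ := hI.sampled k hk t ht htT n hn
  rw [hθ, recourse_eq htT]
  refine (hrisk t ht htT n).2.dualRisk_le_add (fun m => (S.Φ_pos m.1).le) fun m => ?_
  have := hI.stageValue_recourse_le_add hk m.1 (he m)
  rwa [m.2] at this

end IsRun

/-! ### Errors at the sampled nodes -/

/-- The error of the approximation of `𝒬_n` at the decisions of iteration `k`, before the cut of that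
iteration, is at most `e`. -/
def ErrorLE (P : StochasticProgram S d K) (I : Iterates S d) {t : ℕ} (n : S.Node t) (e : ℝ)
    (k : ℕ) : Prop :=
  P.recourse n (I.hist k n) ≤ I.approx (k - 1) n (I.hist k n) + (e : EReal)

/-- A sequence in a compact set has no infinite separated family. -/
theorem not_frequently_of_separated {E : Type*} [PseudoMetricSpace E] {A : Set E}
    (hA : IsCompact A) {x : ℕ → E} {p : ℕ → Prop} (hx : ∀ k, p k → x k ∈ A) {η : ℝ} (hη : 0 < η)
    (h : ∀ k k', p k → p k' → k < k' → η ≤ dist (x k') (x k)) : ¬ ∃ᶠ k in atTop, p k := by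
  intro hfreq
  obtain ⟨u, hu, hp⟩ := extraction_of_frequently_atTop hfreq
  obtain ⟨a, -, v, hv, hlim⟩ := hA.tendsto_subseq fun j => hx (u j) (hp j)
  obtain ⟨N, hN⟩ := Metric.cauchySeq_iff.1 hlim.cauchySeq η hη
  exact (hN (N + 1) (by omega) N le_rfl).not_ge
    (h _ _ (hp _) (hp _) (hu (hv (Nat.lt_succ_self N))))

/-- If the recourse functions of the children are approximated well in the limit, then so is the
recourse function of `n` along the iterations in which `n` is sampled. -/
theorem IsRun.errorLE_of_sampled (hrisk : P.HasCoherentRisk) (H : P.H2) {s : ℕ → S.Scenario}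
    {I : Iterates S d} (hI : P.IsRun s I) {t : ℕ} (ht : 1 ≤ t) (htT : t < T) (n : S.Node t)
    (hm : ∀ m : S.Child n, ∀ e : ℝ, 0 < e → ∀ᶠ k in atTop, P.ErrorLE I m.1 e k) {e : ℝ}
    (he : 0 < e) :
    ¬ ∃ᶠ k in atTop, ¬ P.ErrorLE I n e k ∧ n = (s k).node t htT.le := by
  obtain ⟨φ, δ, C, hδ, hφ, hφC⟩ := exists_real_recourse hrisk H ht htT.le n
  have hK := H.isCompact_prodX htT.le
  have hpos : 0 < e / 4 := by positivity
  have hev : ∀ᶠ k in atTop, 1 ≤ k ∧ ∀ m : S.Child n, P.ErrorLE I m.1 (e / 4) k :=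
    (eventually_ge_atTop 1).and (eventually_all.2 fun m => hm m _ hpos)
  set x : ℕ → Hist d t := fun k => I.hist k n with hxdef
  -- At distance at most `δ` the cut is below `C`, and its value at its base point is at least `-C -
  -- e / 4`; `M` bounds the increase.
  set M : ℝ := 2 * C + e / 4 with hM
  have huc := hK.uniformContinuousOn_of_continuous hφ
  obtain ⟨η₀, hη₀, hη⟩ := Metric.uniformContinuousOn_iff.1 huc (e / 4) hpos
  have hC0 : 0 ≤ C := by
    have h1 := hI.hist_mem_prodX le_rfl n
    exact (abs_nonneg _).trans (hφC _ (Metric.self_subset_cthickening _ h1)).2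
  have hM0 : 0 < M := by positivity
  -- Within `η` both the variation of `φ` and the drop of the cut are at most `e / 4`. With the
  -- inexactness `e / 4` of the cut the total stays below `e`.
  set η := min η₀ (e / 4 / (M / δ)) with hηdef
  have hη0 : 0 < η := lt_min hη₀ (by positivity)
  intro hfreq
  refine not_frequently_of_separated hK (x := x)
    (p := fun k => (¬ P.ErrorLE I n e k ∧ n = (s k).node t htT.le) ∧
      1 ≤ k ∧ ∀ m : S.Child n, P.ErrorLE I m.1 (e / 4) k)
    (fun k hk => hI.hist_mem_prodX hk.2.1 n) hη0 ?_ (hfreq.and_eventually hev)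
  -- The roles differ: `k` supplies the accurate cut, `k'` the large error that this cut
  -- contradicts.
  rintro k k' ⟨⟨-, hn⟩, hk, hmk⟩ ⟨⟨hbad, -⟩, hk', -⟩ hlt
  by_contra! hdist
  have hxk : x k ∈ P.prodX t := hI.hist_mem_prodX hk n
  have hxk' : x k' ∈ P.prodX t := hI.hist_mem_prodX hk' n
  obtain ⟨hφk, hCk⟩ := hφC _ (Metric.self_subset_cthickening _ hxk)
  obtain ⟨hφk', hCk'⟩ := hφC _ (Metric.self_subset_cthickening _ hxk')
  have h1 : P.recourse n (x k) ≤ I.θ k n + ((e / 4 : ℝ) : EReal) :=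
    hI.recourse_le_theta_add hrisk hk ht htT hn hmk
  have h2 : I.θ k n ≤ P.recourse n (x k) := by
    simpa [x] using hI.cut_le_recourse hrisk k ht n (x k)
  rw [hφk] at h1 h2
  obtain ⟨τ, hτ⟩ := EReal.exists_coe_of_ne (x := I.θ k n)
    (fun h => by rw [h, EReal.bot_add] at h1; simp at h1)
    (fun h => by rw [h] at h2; simp at h2)
  rw [hτ] at h1
  have h1' : φ (x k) ≤ τ + e / 4 := by exact_mod_cast h1
  have hslope : ∀ v : Hist d t, ‖v‖ ≤ δ → Hist.dot (I.β k n) v ≤ M := by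
    intro v hv
    have hmem : x k + v ∈ Metric.cthickening δ (P.prodX t) :=
      Metric.mem_cthickening_of_dist_le _ (x k) _ _ hxk (by simpa using hv)
    obtain ⟨h3, h4⟩ := hφC _ hmem
    have h5 := hI.cut_le_recourse hrisk k ht n (x k + v)
    rw [h3, hτ, show x k + v - I.hist k n = v by simp [x]] at h5
    have h6 : τ + Hist.dot (I.β k n) v ≤ φ (x k + v) := by exact_mod_cast h5
    have := (abs_le.1 h4).2
    have := (abs_le.1 hCk).1
    linarith
  have hdot := Hist.neg_mul_norm_le_dot hδ hslope (x k' - x k)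
  -- Since `k < k'`, cut `k` already belongs to the approximation used at iteration `k'`.
  have hcut := I.cut_le_approx (k := k' - 1) (l := k) (by omega) n (x k')
  apply hbad
  unfold ErrorLE
  change P.recourse n (x k') ≤ I.approx (k' - 1) n (x k') + (e : EReal)
  refine le_trans ?_ (add_le_add hcut le_rfl)
  rw [hφk', hτ]
  change _ ≤ (τ : EReal) + ((Hist.dot (I.β k n) (x k' - x k) : ℝ) : EReal) + (e : EReal)
  norm_cast
  have hd1 := hη _ hxk' _ hxk (hdist.trans_le (min_le_left _ _))
  rw [Real.dist_eq] at hd1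
  have hd2 := (abs_lt.1 hd1).2
  have hd3 : M / δ * ‖x k' - x k‖ ≤ e / 4 := by
    rw [← dist_eq_norm]
    have := (hdist.trans_le (min_le_right _ _)).le
    rwa [le_div_iff₀ (by positivity), mul_comm] at this
  linarith

end StochasticProgram

/-! ### Independent sampling -/

/-- A Borel–Cantelli lemma: if each event `A k` is determined by the variables `X j`, `j < k`, of an
independent sequence of variables with finitely many values, and the probabilities of the events
`X k ∈ B` are equal and positive, then almost surely `A k` and `X k ∈ B` occur together infinitely
often as soon as the `A k` do. -/
theorem ae_frequently_and_of_iIndepFun {Ω E : Type*} [MeasurableSpace Ω] {μ : Measure Ω}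
    [IsProbabilityMeasure μ] [MeasurableSpace E] [Finite E] [MeasurableSingletonClass E]
    {X : ℕ → Ω → E} (hX : ∀ k, Measurable (X k)) (hind : iIndepFun X μ) {A : ℕ → Set Ω}
    (hA : ∀ k, ∀ ω ω' : Ω, (∀ j < k, X j ω = X j ω') → ω ∈ A k → ω' ∈ A k) {B : Set E} {q : ℝ}
    (hq : 0 < q) (hB : ∀ k, μ.real (X k ⁻¹' B) = q) :
    ∀ᵐ ω ∂μ, (∃ᶠ k in atTop, ω ∈ A k) → ∃ᶠ k in atTop, ω ∈ A k ∧ X k ω ∈ B := by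
  classical
  let Y : ∀ k, Ω → Fin k → E := fun k ω j => X j ω
  have hY : ∀ k, Measurable (Y k) := fun k => measurable_pi_lambda _ fun j => hX j
  let ℱ : Filtration ℕ (inferInstance : MeasurableSpace Ω) :=
    { seq := fun k => MeasurableSpace.comap (Y k) inferInstance
      mono' := by
        intro k l hkl
        change MeasurableSpace.comap (Y k) _ ≤ MeasurableSpace.comap (Y l) _
        let r : (Fin l → E) → Fin k → E := fun y j => y ⟨j, j.2.trans_le hkl⟩
        have hr : Measurable r := measurable_pi_lambda _ fun j => measurable_pi_apply _
        rw [show Y k = r ∘ Y l from rfl, ← MeasurableSpace.comap_comp]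
        exact MeasurableSpace.comap_mono hr.comap_le
      le' := fun k => (hY k).comap_le }
  have hAm : ∀ k, MeasurableSet[ℱ k] (A k) := by
    intro k
    -- `A k` is a union of fibres of `Y k`, which has finitely many values; this makes it
    -- measurable.
    refine ⟨Y k '' A k, Set.Finite.measurableSet (Set.toFinite _), ?_⟩
    refine Set.Subset.antisymm ?_ (Set.subset_preimage_image _ _)
    rintro ω ⟨ω', hω', h⟩
    exact hA k ω' ω (fun j hj => congrFun h ⟨j, hj⟩) hω'
  have hXm : ∀ k, MeasurableSet[ℱ (k + 1)] (X k ⁻¹' B) := by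
    intro k
    exact ⟨(fun y : Fin (k + 1) → E => y (Fin.last k)) ⁻¹' B,
      Set.Finite.measurableSet (Set.toFinite _), rfl⟩
  -- the events, shifted by one to be adapted
  let C : ℕ → Set Ω := fun k => Nat.casesOn k ∅ fun k => A k ∩ X k ⁻¹' B
  have hC : ∀ k, MeasurableSet[ℱ k] (C k) := by
    intro k
    cases k with
    | zero => exact @MeasurableSet.empty _ (ℱ 0)
    | succ k => exact (ℱ.mono (Nat.le_succ k) _ (hAm k)).inter (hXm k)
  -- Given the past, `A k` is known and `X k` is independent, so the conditional probability is `q`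
  -- on `A k` and 0 elsewhere.
  have hcond : ∀ k, μ[(C (k + 1)).indicator (1 : Ω → ℝ) | ℱ k] =ᵐ[μ]
      (A k).indicator fun _ => q := by
    intro k
    have hXB : MeasurableSet (X k ⁻¹' B) := hX k (Set.Finite.measurableSet (Set.toFinite _))
    have hint : Integrable ((X k ⁻¹' B).indicator (1 : Ω → ℝ)) μ :=
      (integrable_const (1 : ℝ)).indicator hXB
    have h1 : (C (k + 1)).indicator (1 : Ω → ℝ)
        = (A k).indicator ((X k ⁻¹' B).indicator (1 : Ω → ℝ)) :=
      (Set.indicator_indicator _ _ _).symm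
    have h2 : μ[(X k ⁻¹' B).indicator (1 : Ω → ℝ) | ℱ k] =ᵐ[μ] fun _ => q := by
      have hi : Indep (MeasurableSpace.comap (X k) inferInstance) (ℱ k) μ := by
        have h3 := hind.indepFun_finset {k} (Finset.range k) (by simp) hX
        have h4 : IndepFun (X k) (Y k) μ := h3.comp
          (φ := fun u : ({k} : Finset ℕ) → E => u ⟨k, by simp⟩)
          (ψ := fun u : (Finset.range k) → E => fun j : Fin k => u ⟨j, by simp⟩)
          (measurable_pi_apply _) (measurable_pi_lambda _ fun j => measurable_pi_apply _)
        exact h4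
      have h5 := condExp_indep_eq (μ := μ) (hX k).comap_le (ℱ.le k)
        (f := (X k ⁻¹' B).indicator (1 : Ω → ℝ)) ?_ hi
      · refine h5.trans (Eventually.of_forall fun ω => ?_)
        change ∫ ω, (X k ⁻¹' B).indicator (1 : Ω → ℝ) ω ∂μ = q
        rw [integral_indicator_one hXB, hB]
      · refine StronglyMeasurable.indicator stronglyMeasurable_one ?_
        exact ⟨B, Set.Finite.measurableSet (Set.toFinite _), rfl⟩
    rw [h1]
    refine (condExp_indicator hint (hAm k)).trans ?_
    filter_upwards [h2] with ω hω
    simp only [Set.indicator, hω]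
  -- Lévy's criterion: the sum of the conditional probabilities is `q` times the number of the `A k`
  -- that occur, and diverges.
  filter_upwards [ae_mem_limsup_atTop_iff μ hC, ae_all_iff.2 hcond] with ω hω hc hfreq
  have hlim : ω ∈ limsup C atTop := by
    refine hω.2 ?_
    simp only [hc]
    have hcount : Tendsto (fun N => (((Finset.range N).filter fun k => ω ∈ A k).card : ℝ))
        atTop atTop := by
      refine tendsto_natCast_atTop_atTop.comp (tendsto_atTop_atTop.2 fun b => ?_)
      obtain ⟨u, hu, hup⟩ := extraction_of_frequently_atTop hfreq
      refine ⟨u b, fun N hN => ?_⟩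
      calc b = ((Finset.range b).image u).card := by
            rw [Finset.card_image_of_injective _ hu.injective, Finset.card_range]
        _ ≤ _ := by
            refine Finset.card_le_card fun k hk => ?_
            obtain ⟨j, hj, rfl⟩ := Finset.mem_image.1 hk
            exact Finset.mem_filter.2 ⟨Finset.mem_range.2
              ((hu (Finset.mem_range.1 hj)).trans_le hN), hup j⟩
    refine (hcount.atTop_mul_const hq).congr fun N => ?_
    simp [Set.indicator, ← Finset.sum_filter]
  rw [mem_limsup_iff_frequently_mem] at hlim
  rw [frequently_atTop] at hlim ⊢
  intro N
  obtain ⟨k, hk, hmem⟩ := hlim (N + 1)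
  obtain ⟨k, rfl⟩ : ∃ j, k = j + 1 := ⟨k - 1, by omega⟩
  exact ⟨k, by omega, hmem⟩

namespace ScenarioTree

variable {T : ℕ} {S : ScenarioTree T}

instance : Finite S.Scenario := by
  refine Finite.of_injective
    (fun σ : S.Scenario => fun t : Fin (T + 1) => σ.node t (Nat.lt_succ_iff.1 t.2)) ?_
  rintro ⟨f, hf⟩ ⟨g, hg⟩ h
  congr 1
  funext t ht
  exact congrFun h ⟨t, Nat.lt_succ_iff.2 ht⟩

instance : DiscreteMeasurableSpace S.Scenario := ⟨fun _ => trivial⟩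

theorem prob_pos {t : ℕ} (n : S.Node t) : 0 < S.prob n := by
  induction t with
  | zero => exact one_pos
  | succ t ih => exact mul_pos (ih _) (S.Φ_pos n)

/-- Below each node there is a leaf. -/
theorem exists_leaf {t : ℕ} (ht : t ≤ T) (n : S.Node t) :
    ∃ l : S.Node T, ∀ σ : S.Scenario, σ.node T le_rfl = l → σ.node t ht = n := by
  induction ht using Nat.decreasingInduction with
  | self => exact ⟨n, fun _ h => h⟩
  | of_succ t ht ih =>
    have hne : ((Finset.univ : Finset (S.Node (t + 1))).filter
        (fun m => S.parent m = n)).Nonempty := by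
      by_contra h
      have h1 := S.sum_Φ t ht n
      rw [Finset.not_nonempty_iff_eq_empty.1 h] at h1
      simp at h1
    obtain ⟨m, hm⟩ := hne
    obtain ⟨l, hl⟩ := ih m
    refine ⟨l, fun σ hσ => ?_⟩
    rw [← σ.parent_node t ht, hl σ hσ]
    exact (Finset.mem_filter.1 hm).2

/-- If the events `A k`, `k ≥ 1`, are determined by the scenarios of the iterations before `k` and
occur infinitely often, then almost surely they occur infinitely often in iterations in which a
given node is sampled. -/
theorem IsIndependentSampling.ae_frequently_and {Ω : Type*} [MeasurableSpace Ω] {μ : Measure Ω}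
    [IsProbabilityMeasure μ] {s : ℕ → Ω → S.Scenario} (hs : S.IsIndependentSampling μ s)
    {A : ℕ → Set Ω} (hA : ∀ k, 1 ≤ k → ∀ ω ω' : Ω,
      (∀ j, 1 ≤ j → j < k → s j ω = s j ω') → ω ∈ A k → ω' ∈ A k) {t : ℕ} (ht : t ≤ T)
    (n : S.Node t) :
    ∀ᵐ ω ∂μ, (∃ᶠ k in atTop, ω ∈ A k) → ∃ᶠ k in atTop, ω ∈ A k ∧ n = (s k ω).node t ht := by
  -- Sampling one leaf below `n` forces the path through `n`, and the law gives the probability of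
  -- leaves directly.
  obtain ⟨l, hl⟩ := exists_leaf ht n
  have h := ae_frequently_and_of_iIndepFun (X := fun k => s (k + 1)) (μ := μ)
    (fun k => hs.measurable (k + 1) (by omega)) hs.indep (A := fun k => A (k + 1))
    (fun k ω ω' hω => hA (k + 1) (by omega) ω ω' fun j hj hjk => by
      have := hω (j - 1) (by omega)
      rwa [Nat.sub_add_cancel hj] at this)
    (B := {σ | σ.node T le_rfl = l}) (S.prob_pos l) (fun k => by
      rw [Measure.real, show (s (k + 1)) ⁻¹' {σ | σ.node T le_rfl = l}
        = {ω | (s (k + 1) ω).node T le_rfl = l} from rfl, hs.law (k + 1) (by omega),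
        ENNReal.toReal_ofReal (S.prob_pos l).le])
  filter_upwards [h] with ω hω hfreq
  rw [frequently_atTop] at hfreq
  have h1 : ∃ᶠ k in atTop, ω ∈ A (k + 1) := frequently_atTop.2 fun N => by
    obtain ⟨k, hk, hmem⟩ := hfreq (N + 1)
    exact ⟨k - 1, by omega, by rwa [Nat.sub_add_cancel (by omega)]⟩
  have h2 := hω h1
  rw [frequently_atTop] at h2 ⊢
  intro N
  obtain ⟨k, hk, hmem, hB⟩ := h2 N
  exact ⟨k + 1, by omega, hmem, (hl _ hB).symm⟩

end ScenarioTree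

/-! ### Almost sure vanishing of the errors and its consequences -/

namespace StochasticProgram

variable {T : ℕ} {S : ScenarioTree T} {d K : ℕ} {P : StochasticProgram S d K}

section Random

variable {Ω : Type*} {s : ℕ → Ω → S.Scenario} {I : Ω → Iterates S d}

theorem IsGenerated.hist_eq (hI : P.IsGenerated s I) {k : ℕ} (hk : 1 ≤ k) {ω ω' : Ω}
    (h : ∀ j, 1 ≤ j → j < k → s j ω = s j ω') {t : ℕ} (n : S.Node t) :
    (I ω).hist k n = (I ω').hist k n := by
  induction t with
  | zero => exact Subsingleton.elim _ _
  | succ t ih =>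
    simp only [Iterates.hist]
    rw [ih, hI.decision_nonanticipative k hk ω ω' h t n]

theorem IsGenerated.approx_eq (hI : P.IsGenerated s I) {k : ℕ} {ω ω' : Ω}
    (h : ∀ j, 1 ≤ j → j ≤ k → s j ω = s j ω') {t : ℕ} (ht : 1 ≤ t) (htT : t < T) (n : S.Node t)
    (z : Hist d t) : (I ω).approx k n z = (I ω').approx k n z := by
  refine iSup_congr fun l => iSup_congr fun hl => ?_
  have hlk : l ≤ k := Nat.lt_succ_iff.1 (Finset.mem_range.1 hl)
  rcases Nat.eq_zero_or_pos l with rfl | hl0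
  -- Cut 0 is −∞, so the arbitrary history of iteration 0 does not matter.
  · rw [((hI.run ω).init t ht htT n).1, ((hI.run ω').init t ht htT n).1, EReal.bot_add,
      EReal.bot_add]
  · obtain ⟨t, rfl⟩ : ∃ t', t = t' + 1 := ⟨t - 1, by omega⟩
    obtain ⟨h1, h2⟩ := hI.cut_nonanticipative l hl0 ω ω'
      (fun j hj hjl => h j hj (hjl.trans hlk)) t n
    rw [h1, h2, hI.hist_eq hl0 (fun j hj hjl => h j hj (hjl.le.trans hlk)) n]

/-- Almost surely the approximations become exact at the decisions, uniformly over the nodes. -/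
theorem IsGenerated.ae_eventually_errorLE (hrisk : P.HasCoherentRisk) (H : P.H2)
    [MeasurableSpace Ω] {μ : Measure Ω} [IsProbabilityMeasure μ]
    (hs : S.IsIndependentSampling μ s) (hI : P.IsGenerated s I) :
    ∀ᵐ ω ∂μ, ∀ t : ℕ, 1 ≤ t → ∀ n : S.Node t, ∀ e : ℝ, 0 < e →
      ∀ᶠ k in atTop, P.ErrorLE (I ω) n e k := by
  -- Tolerances `1 / (i + 1)` and finitely many nodes per stage leave countably many null sets.
  have hae : ∀ᵐ ω ∂μ, ∀ (t : ℕ) (n : S.Node t) (i : ℕ) (_ : 1 ≤ t) (htT : t < T),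
      (∃ᶠ k in atTop, ¬ P.ErrorLE (I ω) n (1 / (i + 1)) k) →
      ∃ᶠ k in atTop, ¬ P.ErrorLE (I ω) n (1 / (i + 1)) k ∧ n = (s k ω).node t htT.le := by
    refine ae_all_iff.2 fun t => ae_all_iff.2 fun n => ae_all_iff.2 fun i =>
      ae_all_iff.2 fun ht => ae_all_iff.2 fun htT => ?_
    refine hs.ae_frequently_and (A := fun k => {ω | ¬ P.ErrorLE (I ω) n (1 / (i + 1)) k})
      (fun k hk ω ω' h hω => ?_) htT.le n
    simp only [Set.mem_ofPred_eq, ErrorLE] at hω ⊢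
    rwa [← hI.hist_eq hk h n, ← hI.approx_eq (fun j hj hjk => h j hj (by omega)) ht htT n]
  filter_upwards [hae] with ω hω t ht n
  have hrun := hI.run ω
  have hT := le_of_node n
  induction hT using Nat.decreasingInduction with
  | self =>
    refine fun e he => Eventually.of_forall fun k => ?_
    rw [ErrorLE, recourse_leaf, hrun.approx_leaf, zero_add]
    exact_mod_cast he.le
  | of_succ t htT ih =>
    intro e he
    obtain ⟨i, hi⟩ := exists_nat_one_div_lt he
    have h1 := hrun.errorLE_of_sampled hrisk H ht htT n (fun m => ih (by omega) m.1)
      (e := 1 / (i + 1)) (by positivity)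
    have h2 := not_frequently.1 fun h => h1 (hω t n i ht htT h)
    filter_upwards [h2] with k hk
    refine (not_not.1 hk).trans (add_le_add le_rfl ?_)
    exact_mod_cast hi.le

end Random

/-! ### Consequences for a single run -/

section Run

variable {s : ℕ → S.Scenario} {I : Iterates S d}

/-- Minorization gives the upper bound. The lower one is the error bound for index `k - 1`, which
passes to index `k` because approximations increase. -/
theorem IsRun.tendsto_approx_sub_recourse (hrisk : P.HasCoherentRisk) (H : P.H2)
    (hI : P.IsRun s I) {t : ℕ} (ht : 1 ≤ t) (n : S.Node t)
    (hn : ∀ e : ℝ, 0 < e → ∀ᶠ k in atTop, P.ErrorLE I n e k) :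
    Tendsto (fun k : ℕ => I.approx k n (I.hist k n) - P.recourse n (I.hist k n)) atTop (𝓝 0) := by
  obtain ⟨φ, δ, C, hδ, -, hφ⟩ := exists_real_recourse hrisk H ht (le_of_node n) n
  have hreal : ∀ k, 1 ≤ k → P.recourse n (I.hist k n) = φ (I.hist k n) := fun k hk =>
    (hφ _ (Metric.self_subset_cthickening _ (hI.hist_mem_prodX hk n))).1
  have hupper : ∀ k, 1 ≤ k → I.approx k n (I.hist k n) - P.recourse n (I.hist k n) ≤ 0 := by
    intro k hk
    have h1 := hI.approx_le_recourse hrisk k ht n (I.hist k n)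
    rw [hreal k hk] at h1 ⊢
    exact (EReal.sub_le_sub h1 le_rfl).trans_eq (by norm_cast; simp)
  refine tendsto_order.2 ⟨fun a ha => ?_, fun a ha => ?_⟩
  · obtain ⟨r, har, hr⟩ := EReal.lt_iff_exists_real_btwn.1 ha
    have hr0 : r < 0 := by exact_mod_cast hr
    filter_upwards [hn (-r) (by linarith), eventually_ge_atTop 1] with k hk hk1
    refine har.trans_le ?_
    have h1 : (φ (I.hist k n) : EReal) ≤ I.approx k n (I.hist k n) + ((-r : ℝ) : EReal) := by
      rw [← hreal k hk1]
      exact hk.trans (add_le_add (I.approx_mono (by omega) n _) le_rfl)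
    rw [hreal k hk1]
    generalize I.approx k n (I.hist k n) = y at h1
    induction y using EReal.rec with
    | bot => simp at h1
    | top => simp
    | coe y =>
      norm_cast at h1 ⊢
      linarith
  · filter_upwards [eventually_ge_atTop 1] with k hk
    exact (hupper k hk).trans_lt ha

theorem first_stage_pos (S : ScenarioTree T) : 0 < T := le_of_node S.first

theorem hist_first (k : ℕ) : I.hist k S.first = Hist.snoc Fin.elim0 (I.x k S.first) := by
  simp only [Iterates.hist]

theorem optValue_real (hrisk : P.HasCoherentRisk) (H : P.H2) : ∃ v : ℝ, P.optValue = v := by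
  have hT := first_stage_pos S
  obtain ⟨ε, hε, hfat⟩ := H.exists_fat
  obtain ⟨-, hlow, htop⟩ := recourse_properties hrisk H hfat le_rfl hT S.first
  have hmem : (Fin.elim0 : Hist d 0) ∈ P.fatX 0 ε :=
    ⟨Fin.elim0, fun i => i.elim0, by simpa using sq_nonneg ε⟩
  exact EReal.exists_coe_of_ne
    (ne_bot_of_bounded (exists_coe_le_stageValue (H 0 hT) S.first hlow) _)
    (stageValue_ne_top S.first hmem (hfat 0 hT S.first _ hmem) htop)

theorem IsRun.approxOptValue_le (hrisk : P.HasCoherentRisk) (hI : P.IsRun s I) (k : ℕ) :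
    P.approxOptValue I k ≤ P.optValue :=
  stageValue_mono S.first (fun z => hI.approx_le_recourse hrisk k le_rfl S.first z) _

theorem IsRun.tendsto_approxOptValue (hrisk : P.HasCoherentRisk) (H : P.H2) (hI : P.IsRun s I)
    (hn : ∀ e : ℝ, 0 < e → ∀ᶠ k in atTop, P.ErrorLE I S.first e k) :
    Tendsto (fun k : ℕ => P.approxOptValue I k) atTop (𝓝 P.optValue) := by
  obtain ⟨v, hv⟩ := optValue_real hrisk H
  refine tendsto_order.2 ⟨fun a ha => ?_, fun a ha => ?_⟩
  · rw [hv] at ha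
    obtain ⟨r, har, hr⟩ := EReal.lt_iff_exists_real_btwn.1 ha
    have hr0 : r < v := by exact_mod_cast hr
    -- The problem with approximation `k` is the one solved at iteration `k + 1`.
    filter_upwards [(tendsto_add_atTop_nat 1).eventually (hn (v - r) (by linarith))] with k hk
    refine har.trans_le ?_
    have h1 := hI.stageValue_recourse_le_add (k := k + 1) (by omega) S.first hk
    rw [show I.hist (k + 1) (S.parent S.first) = Fin.elim0 from Subsingleton.elim _ _] at h1
    change P.optValue ≤ P.approxOptValue I k + _ at h1
    rw [hv] at h1
    generalize P.approxOptValue I k = y at h1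
    induction y using EReal.rec with
    | bot => simp at h1
    | top => simp
    | coe y =>
      norm_cast at h1 ⊢
      linarith
  · exact Eventually.of_forall fun k => (hI.approxOptValue_le hrisk k).trans_lt ha

theorem isClosed_feasible_first (H : P.H2) :
    IsClosed (P.feasible S.first (Fin.elim0 : Hist d 0)) := by
  have HT := H 0 (first_stage_pos S)
  have hc := Hist.continuous_snoc (Fin.elim0 : Hist d 0)
  have h1 : IsClosed (P.X 1) := HT.X_compact.isClosed
  have h2 : ∀ i, IsClosed {y : Dec d |
      P.g 1 P.x₀ (Hist.snoc (Fin.elim0 : Hist d 0) y) (P.Ψ S.first) i ≤ 0} := fun i =>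
    ((HT.g_lsc S.first i).comp hc).isClosed_preimage 0
  have h3 : IsClosed {y : Dec d | ∑ τ : Fin 2, (P.A S.first τ).mulVec
      (Fin.cons (α := fun _ => Dec d) P.x₀ (Hist.snoc (Fin.elim0 : Hist d 0) y) τ).ofLp
        = P.b S.first} := by
    refine isClosed_eq (continuous_finsetSum _ fun τ _ => ?_) continuous_const
    refine Continuous.matrix_mulVec continuous_const ?_
    refine (PiLp.continuous_ofLp 2 _).comp ?_
    refine Fin.cases ?_ (fun i => ?_) τ
    · simpa using continuous_const
    · exact (continuous_apply i).comp hc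
  have h4 : P.feasible S.first (Fin.elim0 : Hist d 0) = P.X 1 ∩ ((⋂ i, {y : Dec d |
      P.g 1 P.x₀ (Hist.snoc (Fin.elim0 : Hist d 0) y) (P.Ψ S.first) i ≤ 0}) ∩
      {y : Dec d | ∑ τ : Fin 2, (P.A S.first τ).mulVec
        (Fin.cons (α := fun _ => Dec d) P.x₀ (Hist.snoc (Fin.elim0 : Hist d 0) y) τ).ofLp
          = P.b S.first}) := by
    ext y
    simp only [feasible, Set.mem_inter_iff, Set.mem_iInter, Set.mem_ofPred_eq]
  rw [h4]
  exact h1.inter ((isClosed_iInter h2).inter h3)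

/-- The true cost of a computed decision exceeds the optimal value by at most its error. Lower
semicontinuity of `f` and continuity of the recourse function on the decision set pass this to the
accumulation point. -/
theorem IsRun.isOptimalFirstStage_of_mapClusterPt (hrisk : P.HasCoherentRisk) (H : P.H2)
    (hI : P.IsRun s I) (hn : ∀ e : ℝ, 0 < e → ∀ᶠ k in atTop, P.ErrorLE I S.first e k) {y : Dec d}
    (hy : MapClusterPt y atTop fun k : ℕ => I.x k S.first) : P.IsOptimalFirstStage y := by
  have hT := first_stage_pos S
  have HT := H 0 hT
  have hparent : ∀ k, I.hist k (S.parent S.first) = Fin.elim0 := fun k => Subsingleton.elim _ _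
  have hdec : ∀ k, 1 ≤ k → I.x k S.first ∈ P.feasible S.first Fin.elim0 ∧
      P.objective S.first (I.approx (k - 1) S.first) Fin.elim0 (I.x k S.first)
        = P.approxOptValue I (k - 1) := by
    intro k hk
    have := hI.decision k hk 0 hT S.first
    rwa [hparent] at this
  have hfeas : y ∈ P.feasible S.first Fin.elim0 := by
    refine (isClosed_feasible_first H).closure_subset (mem_closure_iff_nhds.2 ?_)
    intro U hU
    obtain ⟨k, hk, hk1⟩ := ((hy.frequently hU).and_eventually (eventually_ge_atTop 1)).exists
    exact ⟨_, hk, (hdec k hk1).1⟩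
  refine ⟨hfeas, le_antisymm ?_ (iInf₂_le (f := fun y (_ : y ∈ P.feasible S.first Fin.elim0) =>
    P.objective S.first (P.recourse S.first) Fin.elim0 y) y hfeas)⟩
  obtain ⟨v, hv⟩ := optValue_real hrisk H
  obtain ⟨φ, δ, C, hδ, hφ, hφC⟩ := exists_real_recourse hrisk H le_rfl hT S.first
  have hmem : ∀ z ∈ P.X 1, Hist.snoc (Fin.elim0 : Hist d 0) z ∈ P.prodX 1 := fun z hz =>
    snoc_mem_prodX (fun i => i.elim0) hz
  have hreal : ∀ z ∈ P.X 1, P.recourse S.first (Hist.snoc Fin.elim0 z)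
      = φ (Hist.snoc Fin.elim0 z) := fun z hz =>
    (hφC _ (Metric.self_subset_cthickening _ (hmem z hz))).1
  have hyX : y ∈ P.X 1 := hfeas.1
  obtain ⟨r, hr⟩ : ∃ r : ℝ, P.f 1 (Hist.snoc Fin.elim0 y) (P.Ψ S.first) = r := by
    obtain ⟨ε, -, hfat⟩ := HT.fat
    exact EReal.exists_coe_of_ne (HT.f_ne_bot _ _) ((hfat S.first Fin.elim0
      ⟨Fin.elim0, fun i => i.elim0, by simpa using sq_nonneg ε⟩).1 y hyX).ne
  rw [hv, objective, hr, hreal y hyX]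
  refine EReal.le_coe_of_forall_pos fun e he => ?_
  -- One third each for the semicontinuity of `f`, the continuity of `φ` and the error at the
  -- decision.
  have he3 : 0 < e / 3 := by positivity
  have h1 : ∀ᶠ z in 𝓝 y, ((r - e / 3 : ℝ) : EReal)
      < P.f 1 (Hist.snoc Fin.elim0 z) (P.Ψ S.first) := by
    refine ((HT.f_lsc S.first).comp (Hist.continuous_snoc Fin.elim0)) y _ ?_
    change ((r - e / 3 : ℝ) : EReal) < P.f 1 (Hist.snoc Fin.elim0 y) (P.Ψ S.first)
    rw [hr]
    exact EReal.coe_lt_coe_iff.2 (by linarith)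
  have h2 : ∀ᶠ z in 𝓝 y, z ∈ P.X 1 →
      φ (Hist.snoc Fin.elim0 y) - e / 3 < φ (Hist.snoc Fin.elim0 z) :=
    eventually_nhdsWithin_iff.1 (((hφ.comp (Hist.continuous_snoc Fin.elim0).continuousOn
      hmem) y hyX).eventually (lt_mem_nhds (by simp [he])))
  obtain ⟨k, ⟨hk1, hk2⟩, hk3, hk⟩ := ((hy.frequently (h1.and h2)).and_eventually
    ((hn _ he3).and (eventually_ge_atTop 1))).exists
  obtain ⟨hxf, hxv⟩ := hdec k hk
  have h3 := hk2 hxf.1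
  rw [ErrorLE, hist_first, hreal _ hxf.1] at hk3
  have h4 : ((r - e / 3 : ℝ) : EReal) + (φ (Hist.snoc Fin.elim0 (I.x k S.first)) : EReal)
      ≤ (v : EReal) + ((e / 3 : ℝ) : EReal) := by
    refine (add_le_add hk1.le hk3).trans ?_
    rw [← add_assoc, ← hv]
    refine add_le_add ?_ le_rfl
    exact hxv.trans_le (hI.approxOptValue_le hrisk _)
  norm_cast at h4 ⊢
  linarith

end Run

end StochasticProgram

theorem theorem3 {T d K : ℕ} {S : ScenarioTree T} (P : StochasticProgram S d K)
    (hrisk : P.HasCoherentRisk) (hH2 : P.H2)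
    {Ω : Type*} [MeasurableSpace Ω] (μ : Measure Ω) [IsProbabilityMeasure μ]
    (s : ℕ → Ω → S.Scenario) (hs : S.IsIndependentSampling μ s)
    (I : Ω → Iterates S d) (hI : P.IsGenerated s I) :
    (∀ᵐ ω ∂μ, ∀ t : ℕ, 1 ≤ t → ∀ n : S.Node t,
      Tendsto (fun k : ℕ => (I ω).approx k n ((I ω).hist k n) - P.recourse n ((I ω).hist k n))
        atTop (𝓝 0)) ∧
    (∀ᵐ ω ∂μ, Tendsto (fun k : ℕ => P.approxOptValue (I ω) k) atTop (𝓝 P.optValue)) ∧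
    (ContinuousOn (fun y : Dec d => P.f 1 (Hist.snoc Fin.elim0 y) (P.Ψ S.first)) (P.X 1) →
      ∀ᵐ ω ∂μ, ∀ y : Dec d, MapClusterPt y atTop (fun k : ℕ => (I ω).x k S.first) →
        P.IsOptimalFirstStage y) := by
  have h := hI.ae_eventually_errorLE hrisk hH2 hs
  refine ⟨?_, ?_, fun _ => ?_⟩
  · filter_upwards [h] with ω hω t ht n
    exact (hI.run ω).tendsto_approx_sub_recourse hrisk hH2 ht n (hω t ht n)
  · filter_upwards [h] with ω hω
    exact (hI.run ω).tendsto_approxOptValue hrisk hH2 (hω 1 le_rfl S.first)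
  · filter_upwards [h] with ω hω y hy
    exact (hI.run ω).isOptimalFirstStage_of_mapClusterPt hrisk hH2 (hω 1 le_rfl S.first) hy
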